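/- Let $\gamma=(1+\sqrt5)/2$. A real number $\xi$ is called \emph{extremal} if it is neither rational nor quadratic over $\mathbb{Q}$ and if there is a constant $c>0$ such that, for each real $X\ge 1$, the system $|x_0|\le X$, $|x_0\xi-x_1|\le cX^{-1/\gamma}$, $|x_0\xi^2-x_2|\le cX^{-1/\gamma}$ has a non-zero solution $(x_0,x_1,x_2)\in\mathbb{Z}^3$. A \emph{Fibonacci sequence} in a monoid is a sequence $(w_i)_{i\ge1}$ with $w_{i+2}=w_{i+1}w_i$ for all $i\ge1$. Let $\mathcal{P}$ be the set of $2\times2$ integer matrices with non-zero determinant whose coefficients have greatest common divisor $1$; it is a group under the operation that sends $(A,B)$ to the product $AB$ divided by the greatest common divisor of its coefficients. A Fibonacci sequence $(W_i)_{i\ge1}$ in $\mathcal{P}$ is \emph{admissible} if there is $N\in\mathcal{P}$ with ${}^tN\ne\pm N$ such that $W_i\,{}^tN$ is symmetric for each odd $i$ and $W_iN$ is symmetric for each even $i$. It is \emph{associated} to $\xi$ if it is admissible and unbounded and if $$\|W_{i+1}\|\asymp\|W_i\|^{\gamma},\qquad \|(\xi,-1)W_i\|\asymp\|W_i\|^{-1},\qquad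 |\det W_i|\asymp1,$$ where $\|A\|$ is the largest absolute value of the coefficients of $A$, and where $\asymp$ means that each side is at most a positive constant, independent of $i$, times the other. \textbf{Theorem.} A real number $\xi$ is extremal with an associated Fibonacci sequence $(W_i)_{i\ge1}$ all of whose terms belong to $\mathrm{GL}_2(\mathbb{Z})$ if and only if there is a Fibonacci sequence $(w_i)_{i\ge1}$ of words over the alphabet $\{1,2,3,\dots\}$ (with concatenation as the product) with $w_1w_2\ne w_2w_1$, converging letter by letter to an infinite word $w_\infty$, such that the sequence of partial quotients of the continued fraction expansion of $\xi$ coincides with $w_\infty$ after removal of finitely many (possibly different numbers of) initial terms from each of the two. Moreover, every Fibonacci sequence of words over the positive integers with $w_1w_2\ne w_2w_1$ converges to an infinite word, and this word is not ultimately periodic. -/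

import Mathlib

open Matrix Filter

noncomputable section

/-! Sequences indexed by the integers `i ≥ 1` are written here as functions on `ℕ`: the value at
`i : ℕ` is the term of index `i + 1`. -/

/-- A Fibonacci sequence in a monoid: `w_{i+2} = w_{i+1} w_i` for all `i`. -/
def IsFibonacci {M : Type*} [Mul M] (w : ℕ → M) : Prop :=
  ∀ i, w (i + 2) = w (i + 1) * w i

/-- The infinite word `a` is the limit, for pointwise convergence, of the sequence of words `w`. -/
def IsLimitWord {E : Type*} (w : ℕ → FreeMonoid E) (a : ℕ → E) : Prop :=
  ∀ n, ∀ᶠ i in atTop, (FreeMonoid.toList (w i))[n]? = some (a n)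

/-- An infinite word is ultimately periodic if it is periodic from some point on. -/
def UltimatelyPeriodic {E : Type*} (a : ℕ → E) : Prop :=
  ∃ p, 1 ≤ p ∧ ∃ k, ∀ i, k ≤ i → a (i + p) = a i

/-- The content of an integer matrix: the greatest (non-negative) common divisor of its
coefficients. -/
def content (A : Matrix (Fin 2) (Fin 2) ℤ) : ℤ :=
  Finset.univ.gcd fun p : Fin 2 × Fin 2 => A p.1 p.2

/-- For `A ≠ 0`, the primitive matrix `red A` with `A = content A • red A`. -/
def red (A : Matrix (Fin 2) (Fin 2) ℤ) : Matrix (Fin 2) (Fin 2) ℤ :=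
  A.map fun x => x / content A

theorem content_dvd (A : Matrix (Fin 2) (Fin 2) ℤ) (i j : Fin 2) : content A ∣ A i j :=
  Finset.gcd_dvd (f := fun p : Fin 2 × Fin 2 => A p.1 p.2) (Finset.mem_univ (i, j))

theorem content_smul_red (A : Matrix (Fin 2) (Fin 2) ℤ) : content A • red A = A := by
  ext i j
  simp [red, Int.mul_ediv_cancel' (content_dvd A i j)]

theorem det_red_ne_zero {A : Matrix (Fin 2) (Fin 2) ℤ} (h : A.det ≠ 0) : (red A).det ≠ 0 := by
  intro h0
  apply h
  rw [← content_smul_red A, Matrix.det_smul, h0, mul_zero]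

theorem content_red {A : Matrix (Fin 2) (Fin 2) ℤ} (h : A.det ≠ 0) : content (red A) = 1 := by
  have hA : ∃ i j, A i j ≠ 0 := by
    by_contra! hc
    exact h (by simp [Matrix.det_fin_two, hc])
  obtain ⟨i, j, hij⟩ := hA
  exact Finset.gcd_div_eq_one (s := Finset.univ) (i := ((i, j) : Fin 2 × Fin 2))
    (f := fun p : Fin 2 × Fin 2 => A p.1 p.2) (Finset.mem_univ _) hij

/-- The set `𝒫` of primitive integer `2 × 2` matrices with non-zero determinant. -/
abbrev PrimMat : Type :=
  {A : Matrix (Fin 2) (Fin 2) ℤ // content A = 1 ∧ A.det ≠ 0}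

/-- The operation `A * B = (A B)^red` on `𝒫`. -/
instance PrimMat.instMul : Mul PrimMat where
  mul A B :=
    have h : (A.1 * B.1).det ≠ 0 := by
      rw [Matrix.det_mul]
      exact mul_ne_zero A.2.2 B.2.2
    ⟨red (A.1 * B.1), content_red h, det_red_ne_zero h⟩

/-- A Fibonacci sequence `(W_i)_{i ≥ 1}` in `𝒫` is admissible if, for some non-symmetric and
non-skew-symmetric `N ∈ 𝒫`, the matrices `W_i Nᵀ` (`i` odd) and `W_i N` (`i` even) are symmetric.
In terms of the shifted index used here, even and odd are exchanged. -/
def IsAdmissible (W : ℕ → PrimMat) : Prop :=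
  IsFibonacci W ∧
    ∃ N : PrimMat, N.1ᵀ ≠ N.1 ∧ N.1ᵀ ≠ -N.1 ∧
      ∀ i, ((W i).1 * (if Even i then N.1ᵀ else N.1)).IsSymm

section
attribute [local instance] Matrix.normedAddCommGroup

/-- The norm of a real matrix: the largest absolute value of its coefficients. -/
def coeffNorm {m n : Type*} [Fintype m] [Fintype n] (A : Matrix m n ℝ) : ℝ := ‖A‖
end

/-- An integer matrix viewed as a real matrix. -/
def toReal (A : Matrix (Fin 2) (Fin 2) ℤ) : Matrix (Fin 2) (Fin 2) ℝ :=
  A.map fun x => (x : ℝ)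

/-- `f ≫≪ g`, with implied constants that do not depend on the index. -/
def Comparable (f g : ℕ → ℝ) : Prop :=
  ∃ c C : ℝ, 0 < c ∧ 0 < C ∧ ∀ i, c * g i ≤ f i ∧ f i ≤ C * g i

/-- `ξ` is extremal: it is neither rational nor quadratic over `ℚ`, and, for some `c > 0`, the
system `|x₀| ≤ X`, `|x₀ ξ - x₁| ≤ c X^{-1/γ}`, `|x₀ ξ² - x₂| ≤ c X^{-1/γ}` has a non-zero integer
solution for each real `X ≥ 1`, where `γ` is the golden ratio. -/
def IsExtremal (ξ : ℝ) : Prop :=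
  Irrational ξ ∧ (∀ p q r : ℤ, p ≠ 0 → p * ξ ^ 2 + q * ξ + r ≠ 0) ∧
    ∃ c : ℝ, 0 < c ∧ ∀ X : ℝ, 1 ≤ X →
      ∃ x₀ x₁ x₂ : ℤ, (x₀, x₁, x₂) ≠ (0, 0, 0) ∧
        |(x₀ : ℝ)| ≤ X ∧
        |x₀ * ξ - x₁| ≤ c * X ^ (-(1 / Real.goldenRatio)) ∧
        |x₀ * ξ ^ 2 - x₂| ≤ c * X ^ (-(1 / Real.goldenRatio))

/-- `W` is a Fibonacci sequence in `𝒫` associated to `ξ`: it is unbounded, admissible, and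
satisfies `‖W_{i+1}‖ ≫≪ ‖W_i‖^γ`, `‖(ξ, -1) W_i‖ ≫≪ ‖W_i‖⁻¹` and `|det W_i| ≫≪ 1`. -/
def IsAssociated (W : ℕ → PrimMat) (ξ : ℝ) : Prop :=
  IsAdmissible W ∧
    ¬ BddAbove (Set.range fun i => coeffNorm (toReal (W i).1)) ∧
    Comparable (fun i => coeffNorm (toReal (W (i + 1)).1))
      (fun i => coeffNorm (toReal (W i).1) ^ Real.goldenRatio) ∧
    Comparable (fun i => coeffNorm (!![ξ, -1] * toReal (W i).1))
      (fun i => (coeffNorm (toReal (W i).1))⁻¹) ∧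
    Comparable (fun i => |((W i).1.det : ℝ)|) (fun _ => 1)

/-- The partial quotients `a₀, a₁, a₂, …` of the continued fraction expansion of `ξ` (with value
`none` beyond the end of a finite expansion). -/
def partialQuotient (ξ : ℝ) : ℕ → Option ℝ
  | 0 => some (GenContFract.of ξ).h
  | n + 1 => (GenContFract.of ξ).partDens.get? n

/-- The sequence of partial quotients of `ξ` coincides with the infinite word `a` after finitely
many initial terms of each of the two are removed. -/
def PartialQuotientsAgree (ξ : ℝ) (a : ℕ → ℕ+) : Prop :=
  ∃ k l : ℕ, ∀ i, partialQuotient ξ (k + i) = some ((a (l + i) : ℕ) : ℝ)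

end

/-! Send a word to the product of the matrices with rows `(b, 1)` and `(1, 0)` over its letters `b`.
This map turns concatenation into the matrix product and is injective. Its values on non-empty words
are exactly the matrices of determinant `±1` with the ordered non-negative entries of `IsContinuant`
(`wordMat_injective`, `IsContinuant.exists_wordMat`).

From words to matrices: an integral change of basis `P`, with inverse `Q`, carries the row `(ξ, -1)`
to a multiple of `(1, -s)`, where `s` has the limit word as its expansion. Conjugating the word
matrices by `P` gives a Fibonacci sequence in `GL₂(ℤ)`. The theory of continuants gives its size and
its action on `(ξ, -1)`. The recursion multiplies norms up to a factor, and this forces the exponent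
`γ`. The matrix `N` is given by an explicit formula, non-degenerate because the commutator of the
first two terms is invertible: otherwise `tr² - 4 det` would be a perfect square. Extremality
follows from the symmetric matrices `V_i N` or `V_i Nᵀ`, whose entries are integer triples nearly
proportional to `(1, ξ, ξ²)`; three consecutive ones are linearly independent, so `ξ` is neither
rational nor quadratic.

From matrices to words: `(ξ, -1) V_i` tends to `0`, and symmetry of `V_i M`, where `M` is `N` or
`Nᵀ`, makes `V_i` nearly annihilate a fixed column `(1, y)`, with `y` irrational and different from
`ξ`. The continued fraction algorithm of `ξ` pushes both numbers `y` into `(-1, 0)`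
(`eventually_neg_of_ne`), while `ξ` becomes some `t > 1`. In these coordinates the large matrices
are nearly multiples of `(t, 1)ᵗ (1, -y)`, hence up to sign word matrices
(`exists_bound_isContinuant`). Their words form a Fibonacci sequence whose limit is the expansion of
`t`.

Non-periodicity: periodicity would make long factors occurring at different places differ by shifts
preserving the tail, and this forces the first two words to commute. -/

open Topology

noncomputable section

/-! ### Fibonacci sequences of words -/

section Words

variable {E : Type*}

/-- The word `u` occurs in the infinite word `a` at position `s`. -/
def OccursAt (a : ℕ → E) (s : ℕ) (u : List E) : Prop :=
  ∀ t, t < u.length → u[t]? = some (a (s + t))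

theorem OccursAt.append_left {a : ℕ → E} {s : ℕ} {u v : List E} (h : OccursAt a s (u ++ v)) :
    OccursAt a s u := by
  intro t ht
  rw [← h t (by simp; omega), List.getElem?_append_left ht]

theorem OccursAt.append_right {a : ℕ → E} {s : ℕ} {u v : List E} (h : OccursAt a s (u ++ v)) :
    OccursAt a (s + u.length) v := by
  intro t ht
  have := h (u.length + t) (by simp; omega)
  rw [List.getElem?_append_right (by omega)] at this
  simpa [add_assoc] using this

theorem OccursAt.eq_of_shift {a : ℕ → E} {s d : ℕ} {u v : List E} (hu : OccursAt a s u)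
    (hv : OccursAt a (s + d) v) (hl : u.length = v.length)
    (h : ∀ t, s ≤ t → a (t + d) = a t) : u = v := by
  apply List.ext_getElem?
  intro t
  by_cases ht : t < u.length
  · rw [hu t ht, hv t (hl ▸ ht), add_right_comm, h _ (by omega)]
  · rw [List.getElem?_eq_none (by omega), List.getElem?_eq_none (by omega)]

/-- A shift that preserves one full period of an ultimately periodic word preserves its tail. -/
theorem shift_eq_of_window {a : ℕ → E} {p k d m : ℕ} (hp : 1 ≤ p)
    (hk : ∀ i, k ≤ i → a (i + p) = a i) (hm : k ≤ m)
    (h : ∀ t, m ≤ t → t < m + p → a (t + d) = a t) : ∀ t, k ≤ t → a (t + d) = a t := by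
  have h1 : ∀ t, m ≤ t → a (t + d) = a t := by
    intro t
    induction t using Nat.strong_induction_on with
    | _ t ih =>
      intro ht
      by_cases htp : t < m + p
      · exact h t ht htp
      · obtain ⟨r, rfl⟩ : ∃ r, t = r + p := ⟨t - p, by omega⟩
        rw [hk r (by omega), add_right_comm, hk (r + d) (by omega)]
        exact ih r (by omega) (by omega)
  have hmul : ∀ n i, k ≤ i → a (i + n * p) = a i := by
    intro n
    induction n with
    | zero => simp
    | succ n ih =>
      intro i hi
      rw [Nat.succ_mul, ← add_assoc, hk _ (by omega), ih i hi]
  intro t ht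
  have h2 := h1 (t + m * p) (by nlinarith)
  rwa [add_right_comm, hmul m _ (by omega), hmul m _ ht] at h2

variable {u : ℕ → List E}

theorem fib_ne_nil (hu : ∀ i, u (i + 2) = u (i + 1) ++ u i) (h : u 0 ++ u 1 ≠ u 1 ++ u 0) :
    ∀ i, u i ≠ [] := by
  have h0 : u 0 ≠ [] := by
    rintro h0
    simp [h0] at h
  have h1 : u 1 ≠ [] := by
    rintro h0
    simp [h0] at h
  intro i
  induction i using Nat.twoStepInduction with
  | zero => exact h0
  | one => exact h1
  | more i _ ih => simp [hu i, ih]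

theorem fib_length (hu : ∀ i, u (i + 2) = u (i + 1) ++ u i) (h : u 0 ++ u 1 ≠ u 1 ++ u 0) (i : ℕ) :
    i < (u (i + 1)).length := by
  induction i with
  | zero => exact List.length_pos_iff.2 (fib_ne_nil hu h 1)
  | succ i ih =>
    have := List.length_pos_iff.2 (fib_ne_nil hu h i)
    rw [hu, List.length_append]
    omega

theorem fib_prefix (hu : ∀ i, u (i + 2) = u (i + 1) ++ u i) (i j : ℕ) :
    u (i + 1) <+: u (i + 1 + j) := by
  induction j with
  | zero => exact List.prefix_rfl
  | succ j ih =>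
    refine ih.trans ?_
    rw [show i + 1 + (j + 1) = i + j + 2 by ring, hu, show i + 1 + j = i + j + 1 by ring]
    exact List.prefix_append _ _

/-- Each term from `u 1` on is a prefix of the next, and `fib_length` makes the letter of index `n`
available in `u (n + 1)`. The term `u 0` is left out because it need not be a prefix of `u 1`. -/
theorem fib_exists_limit (hu : ∀ i, u (i + 2) = u (i + 1) ++ u i)
    (h : u 0 ++ u 1 ≠ u 1 ++ u 0) : ∃ a : ℕ → E, ∀ i, OccursAt a 0 (u (i + 1)) := by
  refine ⟨fun n => (u (n + 1))[n]'(fib_length hu h n), fun i t ht => ?_⟩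
  rw [zero_add]
  rcases le_total i t with hit | hit
  · obtain ⟨j, rfl⟩ := Nat.exists_eq_add_of_le hit
    have h1 := fib_prefix hu i j
    rw [show i + 1 + j = i + j + 1 by ring] at h1
    rw [List.getElem?_eq_getElem ht, Option.some_inj]
    exact h1.getElem ht
  · obtain ⟨j, rfl⟩ := Nat.exists_eq_add_of_le hit
    have h1 := fib_prefix hu t j
    rw [show t + 1 + j = t + j + 1 by ring] at h1
    rw [List.getElem?_eq_getElem ht, Option.some_inj]
    exact (h1.getElem (fib_length hu h t)).symm

/-- Cancelling the common left factor `u (j + 1)` carries commutation one index down. -/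
theorem fib_comm_zero (hu : ∀ i, u (i + 2) = u (i + 1) ++ u i) (j : ℕ)
    (h : u j ++ u (j + 1) = u (j + 1) ++ u j) : u 0 ++ u 1 = u 1 ++ u 0 := by
  induction j with
  | zero => exact h
  | succ j ih =>
    apply ih
    rw [show j + 1 + 1 = j + 2 by ring, hu, List.append_assoc] at h
    exact (List.append_cancel_left h).symm

theorem fib_not_ultimatelyPeriodic (hu : ∀ i, u (i + 2) = u (i + 1) ++ u i)
    (h : u 0 ++ u 1 ≠ u 1 ++ u 0) {a : ℕ → E} (ha : ∀ i, OccursAt a 0 (u (i + 1))) :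
    ¬ UltimatelyPeriodic a := by
  rintro ⟨p, hp, k, hk⟩
  have hlen : ∀ i, (u (i + 2)).length = (u (i + 1)).length + (u i).length := by
    intro i
    rw [hu, List.length_append]
  have e4 : ∀ j, u (j + 4) = u (j + 1) ++ u j ++ u (j + 1) ++ u (j + 1) ++ u j := by
    intro j
    simp [hu (j + 2), hu (j + 1), hu j]
  -- By `e4`, the long word `u (j + 1)` occurs at position `0` and at two later positions whose
  -- difference is its own length. Each occurrence covers a full period, so both shifts preserve the
  -- tail, and so does their difference.
  have key : ∀ j, k + p ≤ j → ∀ t, k ≤ t → a (t + (u (j + 1)).length) = a t := by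
    intro j hj
    have hl := fib_length hu h j
    have o := ha (j + 3)
    rw [e4 j] at o
    have o0 : OccursAt a 0 (u (j + 1)) := ha j
    have o1 := o.append_left.append_left.append_right
    have o2 := o.append_left.append_right
    simp only [List.length_append] at o1 o2
    have s1 : ∀ t, k ≤ t → a (t + ((u (j + 1)).length + (u j).length)) = a t := by
      refine shift_eq_of_window hp hk le_rfl fun t ht ht' => ?_
      have q0 := o0 t (by omega)
      rw [o1 t (by omega)] at q0
      simpa [add_comm] using q0
    have s2 : ∀ t, k ≤ t →
        a (t + ((u (j + 1)).length + (u j).length + (u (j + 1)).length)) = a t := by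
      refine shift_eq_of_window hp hk le_rfl fun t ht ht' => ?_
      have q0 := o0 t (by omega)
      rw [o2 t (by omega)] at q0
      simpa [add_comm] using q0
    refine shift_eq_of_window hp hk (m := k + ((u (j + 1)).length + (u j).length)) (by omega) ?_
    intro t ht _
    obtain ⟨r, rfl⟩ : ∃ r, t = r + ((u (j + 1)).length + (u j).length) :=
      ⟨t - ((u (j + 1)).length + (u j).length), by omega⟩
    rw [s1 r (by omega), add_assoc, s2 r (by omega)]
  obtain ⟨j, hj⟩ : ∃ j, j = k + p := ⟨_, rfl⟩
  have hl := fib_length hu h j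
  have o := ha (j + 3)
  rw [e4 j] at o
  -- The words `u j ++ u (j + 1)` and `u (j + 1) ++ u j` both occur in `u (j + 4)`, at positions
  -- differing by the length of `u (j + 2)`. By `key` this shift preserves the tail, so the two
  -- words are equal.
  have o1 : OccursAt a (u (j + 1)).length (u j ++ u (j + 1)) := by
    simpa using (show OccursAt a 0 (u (j + 1) ++ (u j ++ u (j + 1))) by
      simpa using o.append_left.append_left).append_right
  have o2 : OccursAt a ((u (j + 1)).length + (u (j + 1 + 1)).length) (u (j + 1) ++ u j) := by
    have := (show OccursAt a 0 (u (j + 1) ++ u j ++ u (j + 1) ++ (u (j + 1) ++ u j)) by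
      simpa using o).append_right
    simpa [hu j, add_assoc, add_comm, add_left_comm] using this
  exact h (fib_comm_zero hu j (o1.eq_of_shift o2 (by simp [add_comm])
    fun t ht => key (j + 1) (by omega) t (by omega)))

end Words

/-! ### The matrix of a word -/

/-- The elementary matrix of a partial quotient. -/
def quotMat (b : ℤ) : Matrix (Fin 2) (Fin 2) ℤ := !![b, 1; 1, 0]

/-- The product of the elementary matrices of the letters of a word. -/
def wordMat : List ℕ+ → Matrix (Fin 2) (Fin 2) ℤ
  | [] => 1
  | b :: u => quotMat (b : ℕ) * wordMat u

theorem wordMat_append (u v : List ℕ+) : wordMat (u ++ v) = wordMat u * wordMat v := by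
  induction u with
  | nil => simp [wordMat]
  | cons b u ih => simp [wordMat, ih, mul_assoc]

theorem wordMat_det (u : List ℕ+) : (wordMat u).det = 1 ∨ (wordMat u).det = -1 := by
  induction u with
  | nil => simp [wordMat]
  | cons b u ih =>
    have : (quotMat (b : ℕ)).det = -1 := by simp [quotMat, Matrix.det_fin_two]
    rw [wordMat, Matrix.det_mul, this]
    omega

theorem quotMat_mul (b : ℤ) (A : Matrix (Fin 2) (Fin 2) ℤ) :
    quotMat b * A = !![b * A 0 0 + A 1 0, b * A 0 1 + A 1 1; A 0 0, A 0 1] := by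
  ext i j
  fin_cases i <;> fin_cases j <;> simp [quotMat, Matrix.mul_apply, Fin.sum_univ_two]

/-- The inequalities satisfied by the coefficients of the matrix of a non-empty word. -/
structure IsContinuant (A : Matrix (Fin 2) (Fin 2) ℤ) : Prop where
  nonneg : 0 ≤ A 1 1
  le01 : A 1 1 ≤ A 0 1
  le10 : A 1 1 ≤ A 1 0
  le01' : A 0 1 ≤ A 0 0
  le10' : A 1 0 ≤ A 0 0
  pos01 : 1 ≤ A 0 1
  pos10 : 1 ≤ A 1 0

theorem wordMat_isContinuant (b : ℕ+) (u : List ℕ+) : IsContinuant (wordMat (b :: u)) := by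
  induction u generalizing b with
  | nil =>
    have hb : (1 : ℤ) ≤ (b : ℕ) := by exact_mod_cast b.pos
    constructor <;> simp [wordMat, quotMat] <;> omega
  | cons c u ih =>
    have hb : (1 : ℤ) ≤ (b : ℕ) := by exact_mod_cast b.pos
    obtain ⟨h1, h2, h3, h4, h5, h6, h7⟩ := ih c
    rw [wordMat]
    set A := wordMat (c :: u)
    rw [quotMat_mul]
    constructor <;> simp <;> nlinarith

theorem wordMat_isContinuant_of_ne_nil {u : List ℕ+} (hu : u ≠ []) : IsContinuant (wordMat u) := by
  cases u with
  | nil => exact absurd rfl hu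
  | cons b u => exact wordMat_isContinuant b u

theorem quotMat_mul_injective (b : ℤ) {A B : Matrix (Fin 2) (Fin 2) ℤ}
    (h : quotMat b * A = quotMat b * B) : A = B := by
  rw [quotMat_mul, quotMat_mul] at h
  have h00 := congrFun (congrFun h 0) 0
  have h01 := congrFun (congrFun h 0) 1
  have h10 := congrFun (congrFun h 1) 0
  have h11 := congrFun (congrFun h 1) 1
  simp at h00 h01 h10 h11
  rw [h10] at h00
  rw [h11] at h01
  ext i j
  fin_cases i <;> fin_cases j <;> simp <;> linarith

/-- The lower right entry is `0` for a one-letter word and positive for a longer one. For two longer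
words, the first column determines the first letter, because `1 ≤ A 1 0 ≤ A 0 0` for the matrix of
the remaining letters. -/
theorem wordMat_cons_ne_of_lt {b c : ℕ+} (hbc : b < c) (u v : List ℕ+) :
    wordMat (b :: u) ≠ wordMat (c :: v) := by
  intro h
  have hbc' : ((b : ℕ) : ℤ) + 1 ≤ (c : ℕ) := by exact_mod_cast hbc
  rw [wordMat, wordMat, quotMat_mul, quotMat_mul] at h
  have h00 := congrFun (congrFun h 0) 0
  have h01 := congrFun (congrFun h 0) 1
  have h10 := congrFun (congrFun h 1) 0
  have h11 := congrFun (congrFun h 1) 1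
  simp at h00 h01 h10 h11
  rcases eq_or_ne u [] with rfl | hu <;> rcases eq_or_ne v [] with rfl | hv
  · exact hbc.ne (by simpa [wordMat] using h00)
  · have := wordMat_isContinuant_of_ne_nil hv
    have := this.pos01
    simp [wordMat] at *
    omega
  · have := wordMat_isContinuant_of_ne_nil hu
    have := this.pos01
    simp [wordMat] at *
    omega
  · have h1 := wordMat_isContinuant_of_ne_nil hu
    have h2 := wordMat_isContinuant_of_ne_nil hv
    have := h1.le10'
    have := h2.pos10
    have := h1.pos01
    have := h1.le01'
    nlinarith

theorem wordMat_injective : Function.Injective wordMat := by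
  intro u
  induction u with
  | nil =>
    intro v h
    cases v with
    | nil => rfl
    | cons c v =>
      have h1 := (wordMat_isContinuant c v).pos01
      rw [← h] at h1
      simp [wordMat] at h1
  | cons b u ih =>
    intro v h
    cases v with
    | nil =>
      have h1 := (wordMat_isContinuant b u).pos01
      rw [h] at h1
      simp [wordMat] at h1
    | cons c v =>
      rcases lt_trichotomy b c with hbc | rfl | hbc
      · exact absurd h (wordMat_cons_ne_of_lt hbc u v)
      · rw [ih (quotMat_mul_injective _ h)]
      · exact absurd h.symm (wordMat_cons_ne_of_lt hbc v u)

/-- Euclid's algorithm on the rows, by induction on a bound for the sum of the entries. Determinant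
`±1` makes the two columns ask for the same step. -/
theorem IsContinuant.exists_wordMat {A : Matrix (Fin 2) (Fin 2) ℤ} (hA : IsContinuant A)
    (hdet : A.det = 1 ∨ A.det = -1) : ∃ (b : ℕ+) (u : List ℕ+), wordMat (b :: u) = A := by
  obtain ⟨n, hn⟩ : ∃ n : ℕ, A 0 0 + A 0 1 + A 1 0 + A 1 1 ≤ n :=
    ⟨(A 0 0 + A 0 1 + A 1 0 + A 1 1).toNat, Int.self_le_toNat _⟩
  induction n generalizing A with
  | zero =>
    obtain ⟨h1, h2, h3, h4, h5, h6, h7⟩ := hA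
    push_cast at hn
    omega
  | succ n ih =>
    obtain ⟨h1, h2, h3, h4, h5, h6, h7⟩ := hA
    rw [Matrix.det_fin_two] at hdet
    obtain ⟨p, hp⟩ : ∃ p, p = A 0 0 := ⟨_, rfl⟩
    obtain ⟨p', hp'⟩ : ∃ p, p = A 0 1 := ⟨_, rfl⟩
    obtain ⟨q, hq⟩ : ∃ p, p = A 1 0 := ⟨_, rfl⟩
    obtain ⟨q', hq'⟩ : ∃ p, p = A 1 1 := ⟨_, rfl⟩
    have hA : A = !![p, p'; q, q'] := by
      rw [hp, hp', hq, hq']; exact Matrix.eta_fin_two A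
    rw [← hp, ← hp', ← hq, ← hq'] at hdet hn
    rw [← hq'] at h1 h2 h3
    rw [← hp'] at h2 h4 h6
    rw [← hq] at h3 h5 h7
    rw [← hp] at h4 h5
    clear hp hp' hq hq'
    rcases h1.eq_or_lt with h0 | h0
    · subst h0
      have e : p' * q = 1 := by
        rcases hdet with h | h <;> nlinarith
      have e1 : p' = 1 := by nlinarith
      have e2 : q = 1 := by nlinarith
      subst e1 e2
      refine ⟨⟨p.toNat, by omega⟩, [], ?_⟩
      rw [hA]
      simp [wordMat, quotMat]
      omega
    -- If the top row is at least twice the bottom row, subtracting the latter keeps the shape and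
    -- lowers the first letter by one. Otherwise the first letter is `1` and is split off. The mixed
    -- cases contradict the determinant.
    by_cases hc : 2 * q ≤ p ∧ 2 * q' ≤ p'
    · have hle : p' - q' ≤ p - q := by
        by_contra hlt
        rcases hdet with h | h <;> nlinarith
      obtain ⟨b, u, hbu⟩ := ih (A := !![p - q, p' - q'; q, q'])
        (by constructor <;> simp <;> omega)
        (by
            rw [Matrix.det_fin_two]
            simp only [Matrix.of_apply, Matrix.cons_val', Matrix.cons_val_zero, Matrix.cons_val_one,
              Matrix.cons_val_fin_one]
            rcases hdet with h | h
            · left; linarith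
            · right; linarith) (by simp; push_cast at hn; linarith)
      refine ⟨b + 1, u, ?_⟩
      rw [wordMat, quotMat_mul] at hbu ⊢
      have h00 := congrFun (congrFun hbu 0) 0
      have h01 := congrFun (congrFun hbu 0) 1
      have h10 := congrFun (congrFun hbu 1) 0
      have h11 := congrFun (congrFun hbu 1) 1
      simp at h00 h01 h10 h11
      rw [hA]
      ext i j
      fin_cases i <;> fin_cases j <;> simp <;> linarith
    · have h2q : p ≤ 2 * q := by
        by_contra hlt
        have : p' + 1 ≤ 2 * q' := by
          by_contra hh
          exact hc ⟨by omega, by omega⟩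
        rcases hdet with h | h <;> nlinarith
      have h2q' : p' ≤ 2 * q' := by
        by_contra hlt
        have : p + 1 ≤ 2 * q := by
          by_contra hh
          exact hc ⟨by omega, by omega⟩
        rcases hdet with h | h <;> nlinarith
      have hle : p' - q' ≤ p - q := by
        by_contra hlt
        rcases hdet with h | h <;> nlinarith
      have hpq : q + 1 ≤ p := by
        by_contra hlt
        have : p = q := by omega
        subst this
        rcases hdet with h | h <;> nlinarith
      obtain ⟨b, u, hbu⟩ := ih (A := !![q, q'; p - q, p' - q'])
        (by constructor <;> simp <;> omega)
        (by
          rw [Matrix.det_fin_two]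
          simp only [Matrix.of_apply, Matrix.cons_val', Matrix.cons_val_zero, Matrix.cons_val_one,
            Matrix.cons_val_fin_one]
          rcases hdet with h | h
          · right; linarith
          · left; linarith) (by simp; push_cast at hn; linarith)
      refine ⟨1, b :: u, ?_⟩
      rw [wordMat, hbu, quotMat_mul, hA]
      simp

/-! ### Continued fractions -/

/-- The complete quotients of a real number. -/
def completeQuotient (x : ℝ) : ℕ → ℝ
  | 0 => x
  | n + 1 => completeQuotient (Int.fract x)⁻¹ n

theorem completeQuotient_succ' (x : ℝ) (n : ℕ) :
    completeQuotient x (n + 1) = (Int.fract (completeQuotient x n))⁻¹ := by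
  induction n generalizing x with
  | zero => rfl
  | succ n ih => rw [completeQuotient, ih, completeQuotient]

theorem partialQuotient_zero (x : ℝ) : partialQuotient x 0 = some (⌊x⌋ : ℝ) := by
  simp [partialQuotient]

theorem partialQuotient_succ {x : ℝ} (hx : Int.fract x ≠ 0) (n : ℕ) :
    partialQuotient x (n + 1) = partialQuotient (Int.fract x)⁻¹ n := by
  cases n with
  | zero =>
    have := GenContFract.of_s_head hx
    rw [Stream'.Seq.head] at this
    simp [partialQuotient, GenContFract.partDens, this]
  | succ n =>
    simp [partialQuotient, GenContFract.partDens, GenContFract.of_s_succ]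

theorem partialQuotient_succ_eq_none {x : ℝ} (hx : Int.fract x = 0) (n : ℕ) :
    partialQuotient x (n + 1) = none := by
  have : x = (⌊x⌋ : ℝ) := by
    have := Int.floor_add_fract x
    rw [hx] at this
    linarith
  rw [this]
  simp [partialQuotient, GenContFract.partDens, GenContFract.of_s_of_int]

theorem partialQuotient_add {x : ℝ} {n : ℕ}
    (hx : ∀ m, m < n → Int.fract (completeQuotient x m) ≠ 0) (m : ℕ) :
    partialQuotient x (n + m) = partialQuotient (completeQuotient x n) m := by
  induction n generalizing x with
  | zero => simp [completeQuotient]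
  | succ n ih =>
    rw [show n + 1 + m = n + m + 1 by ring, partialQuotient_succ (x := x) (hx 0 (by omega)), ih,
      completeQuotient]
    intro m hm
    exact hx (m + 1) (by omega)

theorem fract_completeQuotient_ne_zero {x : ℝ}
    (hx : ∀ n, ∃ m, n ≤ m ∧ partialQuotient x m ≠ none) (n : ℕ) :
    Int.fract (completeQuotient x n) ≠ 0 := by
  induction n using Nat.strong_induction_on with
  | _ n ih =>
    intro h0
    obtain ⟨m, hm, hne⟩ := hx (n + 1)
    obtain ⟨r, rfl⟩ := Nat.exists_eq_add_of_le hm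
    apply hne
    rw [show n + 1 + r = n + (r + 1) by ring, partialQuotient_add ih,
      partialQuotient_succ_eq_none h0]

theorem completeQuotient_irrational {x : ℝ} (hx : Irrational x) (n : ℕ) :
    Irrational (completeQuotient x n) := by
  induction n generalizing x with
  | zero => exact hx
  | succ n ih =>
    rw [completeQuotient]
    apply ih
    rw [irrational_inv_iff, Int.fract]
    exact hx.sub_intCast _

theorem fract_ne_zero_of_irrational {x : ℝ} (hx : Irrational x) : Int.fract x ≠ 0 := by
  intro h
  have := Int.floor_add_fract x
  rw [h, add_zero] at this
  exact hx ⟨⌊x⌋, by simpa using this⟩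

theorem partialQuotient_of_irrational {x : ℝ} (hx : Irrational x) (n : ℕ) :
    partialQuotient x n = some (⌊completeQuotient x n⌋ : ℝ) := by
  have := partialQuotient_add (x := x) (n := n)
    (fun m _ => fract_ne_zero_of_irrational (completeQuotient_irrational hx m)) 0
  rw [add_zero] at this
  rw [this, partialQuotient_zero]

theorem one_lt_inv_fract {x : ℝ} (hx : Int.fract x ≠ 0) : 1 < (Int.fract x)⁻¹ :=
  (one_lt_inv₀ ((Int.fract_nonneg x).lt_of_ne' hx)).2 (Int.fract_lt_one x)

theorem eq_floor_add_inv (x : ℝ) : x = ⌊x⌋ + 1 / (Int.fract x)⁻¹ := by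
  rw [one_div, inv_inv, Int.floor_add_fract]

theorem one_le_floor_inv_fract {x : ℝ} (hx : Int.fract x ≠ 0) : 1 ≤ ⌊(Int.fract x)⁻¹⌋ := by
  rw [Int.le_floor]
  exact_mod_cast (one_lt_inv_fract hx).le

/-- Following the continued fraction algorithm of an irrational number `x`, any other irrational
number is eventually mapped into the interval `(-1, 0)`. -/
theorem eventually_neg_of_ne {x : ℝ} (hx : Irrational x) {y : ℕ → ℝ} (hy0 : y 0 ≠ x)
    (hyirr : ∀ n, Irrational (y n))
    (hy : ∀ n, y (n + 1) = 1 / (y n - ⌊completeQuotient x n⌋)) :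
    ∃ k, ∀ n, k ≤ n → -1 < y n ∧ y n < 0 := by
  set z := completeQuotient x with hz
  have hfr : ∀ n, Int.fract (z n) ≠ 0 := fun n =>
    fract_ne_zero_of_irrational (completeQuotient_irrational hx n)
  have hzs : ∀ n, z (n + 1) = (Int.fract (z n))⁻¹ := completeQuotient_succ' x
  have hz1 : ∀ n, 1 < z (n + 1) := fun n => by rw [hzs]; exact one_lt_inv_fract (hfr n)
  have hfl : ∀ n, (1 : ℝ) ≤ ⌊z (n + 1)⌋ := fun n => by
    rw [hzs]
    exact_mod_cast one_le_floor_inv_fract (hfr n)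
  have step : ∀ n, y (n + 1) < 0 → -1 < y (n + 2) ∧ y (n + 2) < 0 := by
    intro n hn
    have h1 : y (n + 1) - ⌊z (n + 1)⌋ < -1 := by linarith [hfl n]
    rw [hy (n + 1)]
    constructor
    · rw [lt_div_iff_of_neg (by linarith)]
      linarith
    · exact div_neg_of_pos_of_neg one_pos (by linarith)
  -- One negative value traps all later ones in `(-1, 0)`. Without any, `y n` and `z n` stay at
  -- distance less than `1`, although each step multiplies their distance by `z (n + 1) * y (n +
  -- 1)`, so that it at least doubles every two steps.
  by_cases hex : ∃ n, y (n + 1) < 0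
  · obtain ⟨k, hk⟩ := hex
    refine ⟨k + 2, fun n hn => ?_⟩
    induction n, hn using Nat.le_induction with
    | base => exact step k hk
    | succ n hn ih =>
      obtain ⟨m, rfl⟩ : ∃ m, n = m + 1 := ⟨n - 1, by omega⟩
      exact step m ih.2
  · exfalso
    have hpos : ∀ n, 0 < y (n + 1) := fun n =>
      lt_of_le_of_ne (not_lt.1 fun h => hex ⟨n, h⟩) (hyirr _).ne_zero.symm
    have hgt : ∀ n, 0 < y n - ⌊z n⌋ := by
      intro n
      have := hpos n
      rw [hy] at this
      exact one_div_pos.1 this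
    have hy1 : ∀ n, 1 < y (n + 1) := fun n => by linarith [hgt (n + 1), hfl n]
    have hlt : ∀ n, |z n - y n| < 1 := by
      intro n
      have h1 : y n - ⌊z n⌋ < 1 := by
        have := hy1 n
        rw [hy, lt_div_iff₀ (hgt n)] at this
        linarith
      have h2 := Int.floor_le (z n)
      have h3 := Int.lt_floor_add_one (z n)
      have := hgt n
      rw [abs_lt]
      constructor <;> linarith
    have hzy : ∀ n, z n - y n = -(z (n + 1) - y (n + 1)) / (z (n + 1) * y (n + 1)) := by
      intro n
      have e1 : z n = ⌊z n⌋ + 1 / z (n + 1) := by rw [hzs]; exact eq_floor_add_inv _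
      have e2 : y n = ⌊z n⌋ + 1 / y (n + 1) := by
        rw [hy]
        simp
      have h0 : z (n + 1) ≠ 0 := by linarith [hz1 n]
      have h0' := (hpos n).ne'
      have e3 : z n - y n = 1 / z (n + 1) - 1 / y (n + 1) := by linarith
      rw [e3]
      field_simp
      ring
    have habs : ∀ n, |z (n + 1) - y (n + 1)| = |z n - y n| * (z (n + 1) * y (n + 1)) := by
      intro n
      have hp : 0 < z (n + 1) * y (n + 1) := mul_pos (by linarith [hz1 n]) (hpos n)
      rw [hzy n, abs_div, abs_neg, abs_of_pos hp, div_mul_cancel₀ _ hp.ne']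
    have hzz : ∀ n, 2 ≤ z (n + 1) * z (n + 2) := by
      intro n
      have e1 : z (n + 1) = ⌊z (n + 1)⌋ + 1 / z (n + 2) := by
        rw [hzs (n + 1)]; exact eq_floor_add_inv _
      have h2 := hz1 (n + 1)
      have : z (n + 1) * z (n + 2) = ⌊z (n + 1)⌋ * z (n + 2) + 1 := by
        have h0 : z (n + 2) ≠ 0 := by positivity
        nth_rewrite 1 [e1]
        field_simp
      rw [this]
      nlinarith [hfl n]
    have hdbl : ∀ n, 2 * |z n - y n| ≤ |z (n + 2) - y (n + 2)| := by
      intro n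
      rw [habs (n + 1), habs n]
      have h1 := hz1 n
      have h2 := hz1 (n + 1)
      have h3 := hy1 n
      have h4 := hy1 (n + 1)
      have h5 := hzz n
      have h6 : 1 ≤ y (n + 1) * y (n + 2) := by nlinarith
      have h7 : 2 ≤ (z (n + 1) * z (n + 2)) * (y (n + 1) * y (n + 2)) := by nlinarith
      have := mul_le_mul_of_nonneg_left h7 (abs_nonneg (z n - y n))
      calc 2 * |z n - y n| ≤ |z n - y n| *
            (z (n + 1) * z (n + 2) * (y (n + 1) * y (n + 2))) := by linarith
        _ = _ := by ring_nf
    have hgrow : ∀ n : ℕ, 2 ^ n * |z 0 - y 0| ≤ |z (2 * n) - y (2 * n)| := by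
      intro n
      induction n with
      | zero => simp
      | succ n ih =>
        have := hdbl (2 * n)
        rw [show 2 * (n + 1) = 2 * n + 2 by ring, pow_succ]
        linarith
    have h0 : 0 < |z 0 - y 0| := abs_pos.2 (sub_ne_zero.2 hy0.symm)
    obtain ⟨n, hn⟩ := pow_unbounded_of_one_lt (1 / |z 0 - y 0|) (one_lt_two (α := ℝ))
    rw [div_lt_iff₀ h0] at hn
    linarith [hgrow n, hlt (2 * n)]

/-- The ratio of the first column lies between `a 0` and `a 0 + 1`, with denominator at least `1`,
so an error tending to `0` puts `x` in the same interval. Irrationality excludes the right endpoint.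
-/
theorem floor_eq_of_tendsto {x : ℝ} (hx : Irrational x) {u : ℕ → List ℕ+}
    {a : ℕ → ℕ+} (ha : ∀ n, ∀ᶠ i in atTop, (u i)[n]? = some (a n))
    (h : Tendsto (fun i => (wordMat (u i) 0 0 : ℝ) - x * (wordMat (u i) 1 0 : ℝ)) atTop (𝓝 0)) :
    ⌊x⌋ = (a 0 : ℕ) := by
  have key : ∀ᶠ i in atTop, ∃ B : Matrix (Fin 2) (Fin 2) ℤ, IsContinuant B ∧
      wordMat (u i) = quotMat (a 0 : ℕ) * B := by
    -- The second letter is required so that the rest of the word is non-empty and its matrix is a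
    -- continuant.
    filter_upwards [ha 0, ha 1] with i h0 h1
    rcases hu : u i with _ | ⟨b, _ | ⟨c, v⟩⟩
    · simp [hu] at h0
    · simp [hu] at h1
    · simp only [hu, List.getElem?_cons_zero, Option.some_inj] at h0
      exact ⟨wordMat (c :: v), wordMat_isContinuant c v, by rw [← h0]; rfl⟩
  have h1 : ((a 0 : ℕ) : ℝ) ≤ x := by
    by_contra hlt
    push Not at hlt
    have : ((a 0 : ℕ) : ℝ) - x ≤ 0 := by
      refine ge_of_tendsto h ?_
      filter_upwards [key] with i hi
      obtain ⟨B, hB, hi⟩ := hi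
      rw [hi, quotMat_mul]
      have b1 : (1 : ℝ) ≤ B 0 0 := by exact_mod_cast hB.pos10.trans hB.le10'
      have b2 : (1 : ℝ) ≤ B 1 0 := by exact_mod_cast hB.pos10
      simp
      nlinarith
    linarith
  have h2 : x ≤ (a 0 : ℕ) + 1 := by
    by_contra hlt
    push Not at hlt
    have : 0 ≤ ((a 0 : ℕ) : ℝ) + 1 - x := by
      refine le_of_tendsto h ?_
      filter_upwards [key] with i hi
      obtain ⟨B, hB, hi⟩ := hi
      rw [hi, quotMat_mul]
      have b1 : (1 : ℝ) ≤ B 0 0 := by exact_mod_cast hB.pos10.trans hB.le10'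
      have b2 : (B 1 0 : ℝ) ≤ B 0 0 := by exact_mod_cast hB.le10'
      simp
      nlinarith
    linarith
  rw [Int.floor_eq_iff]
  refine ⟨by exact_mod_cast h1, lt_of_le_of_ne (by exact_mod_cast h2) ?_⟩
  have := hx.ne_nat ((a 0 : ℕ) + 1)
  push_cast at this ⊢
  exact this

/-- If the first columns of the matrices of a convergent sequence of words approximate `x`, then
the limit word is the sequence of partial quotients of `x`. -/
theorem floor_completeQuotient_of_tendsto (n : ℕ) {x : ℝ} (hx : Irrational x) {u : ℕ → List ℕ+}
    {a : ℕ → ℕ+} (ha : ∀ n, ∀ᶠ i in atTop, (u i)[n]? = some (a n))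
    (h : Tendsto (fun i => (wordMat (u i) 0 0 : ℝ) - x * (wordMat (u i) 1 0 : ℝ)) atTop (𝓝 0)) :
    ⌊completeQuotient x n⌋ = (a n : ℕ) := by
  induction n generalizing x u a with
  | zero => exact floor_eq_of_tendsto hx ha h
  | succ n ih =>
    have hzero := floor_eq_of_tendsto hx ha h
    have hfr := fract_ne_zero_of_irrational hx
    refine ih (x := (Int.fract x)⁻¹) (u := fun i => (u i).tail) (a := fun n => a (n + 1))
      (completeQuotient_irrational hx 1) (fun n => ?_) ?_
    · filter_upwards [ha (n + 1)] with i hi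
      rw [List.getElem?_tail, hi]
    -- Dropping the first letter and replacing `x` by `1 / fract x` multiplies the error by `-1 /
    -- fract x`.
    · have h1 := h.const_mul (-(Int.fract x)⁻¹)
      rw [mul_zero] at h1
      refine h1.congr' ?_
      filter_upwards [ha 0] with i h0
      rcases hu : u i with _ | ⟨b, v⟩
      · simp [hu] at h0
      · simp only [hu, List.getElem?_cons_zero, Option.some_inj] at h0
        have e : x = (a 0 : ℕ) + Int.fract x := by
          conv_lhs => rw [← Int.floor_add_fract x, hzero]
          simp
        rw [wordMat, quotMat_mul, h0]
        simp
        have e2 : x - (a 0 : ℕ) = Int.fract x := by linarith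
        field_simp
        rw [← e2]
        ring

/-! ### Norms -/

section Norms

variable {m n : Type*} [Fintype m] [Fintype n]

theorem abs_le_coeffNorm (A : Matrix m n ℝ) (i : m) (j : n) : |A i j| ≤ coeffNorm A :=
  Matrix.norm_entry_le_entrywise_sup_norm A

theorem coeffNorm_le {A : Matrix m n ℝ} {r : ℝ} (hr : 0 ≤ r) (h : ∀ i j, |A i j| ≤ r) :
    coeffNorm A ≤ r :=
  (Matrix.norm_le_iff hr).2 h

theorem coeffNorm_nonneg (A : Matrix m n ℝ) : 0 ≤ coeffNorm A := by
  let _ := Matrix.normedAddCommGroup (m := m) (n := n) (α := ℝ)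
  exact norm_nonneg A

theorem coeffNorm_mul_le (A : Matrix m (Fin 2) ℝ) (B : Matrix (Fin 2) n ℝ) :
    coeffNorm (A * B) ≤ 2 * coeffNorm A * coeffNorm B := by
  have hA := coeffNorm_nonneg A
  have hB := coeffNorm_nonneg B
  refine coeffNorm_le (by positivity) fun i j => ?_
  rw [Matrix.mul_apply, Fin.sum_univ_two]
  refine (abs_add_le _ _).trans ?_
  rw [abs_mul, abs_mul]
  have h1 := mul_le_mul (abs_le_coeffNorm A i 0) (abs_le_coeffNorm B 0 j) (abs_nonneg _) hA
  have h2 := mul_le_mul (abs_le_coeffNorm A i 1) (abs_le_coeffNorm B 1 j) (abs_nonneg _) hA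
  linarith

end Norms

theorem toReal_mul (A B : Matrix (Fin 2) (Fin 2) ℤ) : toReal (A * B) = toReal A * toReal B :=
  Matrix.map_mul (f := Int.castRingHom ℝ)

theorem toReal_one : toReal 1 = 1 := by
  ext i j
  fin_cases i <;> fin_cases j <;> simp [toReal]

theorem one_le_coeffNorm {A : Matrix (Fin 2) (Fin 2) ℤ} (hA : A.det ≠ 0) :
    1 ≤ coeffNorm (toReal A) := by
  obtain ⟨i, j, hij⟩ : ∃ i j, A i j ≠ 0 := by
    by_contra! hc
    exact hA (by simp [Matrix.det_fin_two, hc])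
  refine le_trans ?_ (abs_le_coeffNorm (toReal A) i j)
  have := Int.one_le_abs hij
  simp only [toReal, Matrix.map_apply]
  exact_mod_cast this

/-- A sequence of reals `≥ 1` that is unbounded and satisfies `X_{i+1} ≫ X_i ^ γ` tends to
infinity. -/
theorem tendsto_atTop_of_comparable {X : ℕ → ℝ} (hX1 : ∀ i, 1 ≤ X i)
    (hX : ¬ BddAbove (Set.range X)) {c : ℝ} (hc : 0 < c)
    (h : ∀ i, c * X i ^ Real.goldenRatio ≤ X (i + 1)) : Tendsto X atTop atTop := by
  have hg := Real.one_lt_goldenRatio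
  have hg' : 0 < Real.goldenRatio - 1 := by linarith
  -- Beyond `R` one has `c * X ^ (γ - 1) ≥ 2`, so the sequence at least doubles from there on.
  set R := (2 / c) ^ (1 / (Real.goldenRatio - 1)) with hR
  have hR0 : 0 < R := by positivity
  have step : ∀ i, R ≤ X i → 2 * X i ≤ X (i + 1) := by
    intro i hi
    have hXi : 0 < X i := by linarith [hX1 i]
    have h1 : 2 / c ≤ X i ^ (Real.goldenRatio - 1) := by
      have := Real.rpow_le_rpow hR0.le hi hg'.le
      rwa [hR, ← Real.rpow_mul (by positivity), one_div_mul_cancel hg'.ne', Real.rpow_one] at this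
    have h2 : X i ^ Real.goldenRatio = X i ^ (Real.goldenRatio - 1) * X i := by
      rw [← Real.rpow_add_one hXi.ne']
      ring_nf
    rw [div_le_iff₀ hc] at h1
    refine le_trans ?_ (h i)
    rw [h2]
    nlinarith
  obtain ⟨k, hk⟩ : ∃ k, R ≤ X k := by
    by_contra! hlt
    exact hX ⟨R, by rintro _ ⟨i, rfl⟩; exact (hlt i).le⟩
  have hpow : ∀ n : ℕ, R ≤ X (n + k) ∧ (2 : ℝ) ^ n ≤ X (n + k) := by
    intro n
    induction n with
    | zero => simpa using ⟨hk, hX1 k⟩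
    | succ n ih =>
      have := step _ ih.1
      rw [show n + 1 + k = n + k + 1 by ring, pow_succ]
      constructor
      · linarith [hX1 (n + k)]
      · linarith [ih.2]
  rw [← tendsto_add_atTop_iff_nat k]
  exact tendsto_atTop_mono (fun n => (hpow n).2) (tendsto_pow_atTop_atTop_of_one_lt one_lt_two)

/-! ### Symmetric points attached to a Fibonacci sequence of matrices -/

/-- The alternating sequence `Nᵀ, N, Nᵀ, N, …`. -/
def altMat (N : Matrix (Fin 2) (Fin 2) ℤ) (i : ℕ) : Matrix (Fin 2) (Fin 2) ℤ :=
  if Even i then Nᵀ else N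

theorem altMat_succ (N : Matrix (Fin 2) (Fin 2) ℤ) (i : ℕ) :
    altMat N (i + 1) = (altMat N i)ᵀ := by
  unfold altMat
  by_cases h : Even i <;> simp [h, Nat.even_add_one]

theorem altMat_add_two (N : Matrix (Fin 2) (Fin 2) ℤ) (i : ℕ) :
    altMat N (i + 2) = altMat N i := by
  rw [altMat_succ, altMat_succ, Matrix.transpose_transpose]

theorem altMat_det (N : Matrix (Fin 2) (Fin 2) ℤ) (i : ℕ) : (altMat N i).det = N.det := by
  unfold altMat
  split_ifs <;> simp

/-- With `M i = altMat N i`, symmetry at `i + 1` gives `V (i + 3) M (i + 3) = V (i + 1) (V i M i) (V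
(i + 1))ᵀ`, a congruence transform of a symmetric matrix. -/
theorem isSymm_mul_of_isSymm {V : ℕ → Matrix (Fin 2) (Fin 2) ℤ} (hV : IsFibonacci V)
    {N : Matrix (Fin 2) (Fin 2) ℤ} (h0 : (V 0 * altMat N 0).IsSymm)
    (h1 : (V 1 * altMat N 1).IsSymm) (h2 : (V 2 * altMat N 2).IsSymm) (i : ℕ) :
    (V i * altMat N i).IsSymm := by
  suffices H : (V i * altMat N i).IsSymm ∧ (V (i + 1) * altMat N (i + 1)).IsSymm ∧
      (V (i + 2) * altMat N (i + 2)).IsSymm from H.1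
  induction i with
  | zero => exact ⟨h0, h1, h2⟩
  | succ i ih =>
    obtain ⟨i0, i1, i2⟩ := ih
    refine ⟨i1, i2, ?_⟩
    have e : V (i + 1) * (altMat N i)ᵀ = altMat N i * (V (i + 1))ᵀ := by
      have := i1.eq
      rw [altMat_succ, Matrix.transpose_mul, Matrix.transpose_transpose] at this
      exact this.symm
    have e2 : V (i + 3) * altMat N (i + 3) =
        V (i + 1) * (V i * altMat N i) * (V (i + 1))ᵀ := by
      rw [altMat_add_two, altMat_succ, hV (i + 1), hV i]
      simp only [mul_assoc, e]
    rw [show i + 1 + 2 = i + 3 by ring, e2, Matrix.IsSymm, Matrix.transpose_mul,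
      Matrix.transpose_mul, Matrix.transpose_transpose, i0.eq, ← mul_assoc]

theorem mul_altMat_add_two {V : ℕ → Matrix (Fin 2) (Fin 2) ℤ} (hV : IsFibonacci V)
    {N : Matrix (Fin 2) (Fin 2) ℤ} (h : ∀ i, (V i * altMat N i).IsSymm) (i : ℕ) :
    V (i + 2) * altMat N (i + 2) = V i * (V (i + 1) * altMat N (i + 1)) := by
  have e := (h (i + 1)).eq
  rw [altMat_succ, Matrix.transpose_mul, Matrix.transpose_transpose] at e
  rw [← (h (i + 2)).eq, altMat_add_two, hV i, altMat_succ, ← e, mul_assoc, Matrix.transpose_mul,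
    (h i).eq, mul_assoc]

/-- Three consecutive symmetric points are not coplanar. -/
theorem eq_zero_of_orthogonal {A M Y : Matrix (Fin 2) (Fin 2) ℤ}
    (hA : A.det ≠ 0) (hY : Y.det ≠ 0) (hMs : Mᵀ ≠ M)
    (h0 : (A * M).IsSymm) (h1 : Y.IsSymm) (h2 : (A * Y).IsSymm) {p q r : ℤ}
    (hort : ∀ Z ∈ ({A * M, Y, A * Y} : Set (Matrix (Fin 2) (Fin 2) ℤ)),
      r * Z 0 0 + q * Z 0 1 + p * Z 1 1 = 0) : p = 0 ∧ q = 0 ∧ r = 0 := by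
  have o0 := hort (A * M) (by simp)
  have o1 := hort Y (by simp)
  have o2 := hort (A * Y) (by simp)
  have s0 := h0.apply 0 1
  have s1 := h1.apply 0 1
  have s2 := h2.apply 0 1
  have hm : M 0 1 - M 1 0 ≠ 0 := by
    intro h
    apply hMs
    ext i j
    fin_cases i <;> fin_cases j <;> simp <;> omega
  let T : Matrix (Fin 3) (Fin 3) ℤ :=
    !![(A * M) 0 0, (A * M) 0 1, (A * M) 1 1; Y 0 0, Y 0 1, Y 1 1;
      (A * Y) 0 0, (A * Y) 0 1, (A * Y) 1 1]
  -- The determinant of the three points factors, and its last factor vanishes only for symmetric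
  -- `M`.
  have hT : T.det = -(A.det * Y.det * (M 0 1 - M 1 0)) := by
    simp only [Matrix.mul_apply, Fin.sum_univ_two] at s0 s2
    rw [s1] at s2
    simp only [T, Matrix.det_fin_three, Matrix.det_fin_two, Matrix.mul_apply, Fin.sum_univ_two,
      Matrix.of_apply, Matrix.cons_val', Matrix.cons_val_zero, Matrix.cons_val_one,
      Matrix.cons_val_fin_one, Matrix.cons_val, s1]
    grind
  have hT0 : T.det ≠ 0 := by
    rw [hT]
    exact neg_ne_zero.2 (mul_ne_zero (mul_ne_zero hA hY) hm)
  have hv : T *ᵥ ![r, q, p] = 0 := by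
    ext i
    fin_cases i
    · simp [T, Matrix.mulVec, dotProduct, Fin.sum_univ_three]
      linarith
    · simp [T, Matrix.mulVec, dotProduct, Fin.sum_univ_three]
      linarith
    · simp [T, Matrix.mulVec, dotProduct, Fin.sum_univ_three]
      linarith
  have h0 := Matrix.eq_zero_of_mulVec_eq_zero hT0 hv
  exact ⟨by simpa using congrFun h0 2, by simpa using congrFun h0 1, by simpa using congrFun h0 0⟩

theorem coeffNorm_altMat_le (N : Matrix (Fin 2) (Fin 2) ℤ) (i : ℕ) :
    coeffNorm (toReal (altMat N i)) ≤ coeffNorm (toReal N) := by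
  refine coeffNorm_le (coeffNorm_nonneg _) fun j k => ?_
  unfold altMat
  split_ifs
  · exact abs_le_coeffNorm (toReal N) k j
  · exact abs_le_coeffNorm (toReal N) j k

/-! ### Approximating points and extremality -/

/-- A Fibonacci sequence in `GL₂(ℤ)` attached to `x` through an invertible non-symmetric `N`, and
whose terms send `(x, -1)` to vectors of norm `≪ ‖V i‖⁻¹`. -/
structure Approximates (x : ℝ) (N : Matrix (Fin 2) (Fin 2) ℤ)
    (V : ℕ → Matrix (Fin 2) (Fin 2) ℤ) (C : ℝ) : Prop where
  fib : IsFibonacci V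
  det : ∀ i, (V i).det ≠ 0
  detN : N.det ≠ 0
  transpose_ne : Nᵀ ≠ N
  symm : ∀ i, (V i * altMat N i).IsSymm
  pos : 0 < C
  bound : ∀ i, coeffNorm (!![x, -1] * toReal (V i)) ≤ C * (coeffNorm (toReal (V i)))⁻¹
  tendsto : Tendsto (fun i => coeffNorm (toReal (V i))) atTop atTop

namespace Approximates

variable {x : ℝ} {N : Matrix (Fin 2) (Fin 2) ℤ} {V : ℕ → Matrix (Fin 2) (Fin 2) ℤ} {C : ℝ}

/-- The row `(x, -1)` times the point `V i * altMat N i` is small. As the point is symmetric, `x y₀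
- y₁` and `x y₁ - y₂` are both small, and `x² y₀ - y₂ = x (x y₀ - y₁) + (x y₁ - y₂)`. -/
theorem point_bound (h : Approximates x N V C) :
    ∃ K : ℝ, 0 < K ∧ ∀ i, |((V i * altMat N i) 0 0 : ℝ)| ≤ K * coeffNorm (toReal (V i)) ∧
      |((V i * altMat N i) 0 0 : ℝ) * x - (V i * altMat N i) 0 1| ≤
        K * (coeffNorm (toReal (V i)))⁻¹ ∧
      |((V i * altMat N i) 0 0 : ℝ) * x ^ 2 - (V i * altMat N i) 1 1| ≤
        K * (coeffNorm (toReal (V i)))⁻¹ := by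
  have hN := one_le_coeffNorm h.detN
  have hC := h.pos
  set n := coeffNorm (toReal N) with hn
  have hx := abs_nonneg x
  refine ⟨(1 + |x|) * (2 * C * n) + 2 * n, by positivity, fun i => ?_⟩
  have hVi := one_le_coeffNorm (h.det i)
  set v := coeffNorm (toReal (V i)) with hv
  have hNi := coeffNorm_altMat_le N i
  have e1 := abs_le_coeffNorm (toReal (V i * altMat N i)) 0 0
  rw [toReal_mul] at e1
  have e1' := e1.trans (coeffNorm_mul_le _ _)
  have e2 : ∀ j, |(!![x, -1] * toReal (V i * altMat N i)) 0 j| ≤ 2 * C * n * v⁻¹ := by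
    intro j
    rw [toReal_mul, ← Matrix.mul_assoc]
    refine (abs_le_coeffNorm _ 0 j).trans ((coeffNorm_mul_le _ _).trans ?_)
    have hb := h.bound i
    calc 2 * coeffNorm (!![x, -1] * toReal (V i)) * coeffNorm (toReal (altMat N i))
        ≤ 2 * (C * v⁻¹) * n := by
          gcongr
          exact coeffNorm_nonneg _
      _ = _ := by ring
  have s := (h.symm i).apply 0 1
  have e20 := e2 0
  have e21 := e2 1
  simp only [Matrix.mul_apply (M := !![x, -1]), Fin.sum_univ_two, toReal, Matrix.map_apply,
    Matrix.of_apply, Matrix.cons_val', Matrix.cons_val_zero, Matrix.cons_val_one,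
    Matrix.cons_val_fin_one] at e20 e21
  rw [s] at e20
  rw [← toReal_mul] at e1'
  simp only [toReal, Matrix.map_apply] at e1'
  set y := V i * altMat N i
  have hvi : 0 < v⁻¹ := by positivity
  have hp : 0 ≤ 2 * C * n * v⁻¹ := by positivity
  refine ⟨e1'.trans ?_, ?_, ?_⟩
  · have : 2 * v * coeffNorm (toReal (altMat N i)) ≤ 2 * v * n := by gcongr
    have h3 : 0 ≤ (1 + |x|) * (2 * C * n) * v := by positivity
    exact this.trans (by linarith)
  · have h3 : 0 ≤ |x| * (2 * C * n * v⁻¹) + 2 * n * v⁻¹ := by positivity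
    have h4 : (y 0 0 : ℝ) * x - y 0 1 = x * y 0 0 + -1 * y 0 1 := by ring
    rw [h4]
    linarith
  · have h3 : 0 ≤ 2 * n * v⁻¹ := by positivity
    have h4 : (y 0 0 : ℝ) * x ^ 2 - y 1 1 =
      x * (x * y 0 0 + -1 * y 0 1) + (x * y 0 1 + -1 * y 1 1) := by ring
    rw [h4]
    refine (abs_add_le _ _).trans ?_
    rw [abs_mul]
    have := mul_le_mul_of_nonneg_left e20 hx
    linarith

/-- `x` is neither rational nor quadratic. -/
theorem eq_zero_of_quadratic (h : Approximates x N V C) {p q r : ℤ}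
    (hx : (p : ℝ) * x ^ 2 + q * x + r = 0) : p = 0 ∧ q = 0 ∧ r = 0 := by
  obtain ⟨K, hK, hb⟩ := h.point_bound
  have hev : ∀ᶠ i in atTop, r * (V i * altMat N i) 0 0 + q * (V i * altMat N i) 0 1 +
      p * (V i * altMat N i) 1 1 = 0 := by
    filter_upwards [h.tendsto.eventually_gt_atTop ((|(q : ℝ)| + |(p : ℝ)|) * K)] with i hi
    obtain ⟨-, h1, h2⟩ := hb i
    have hVi := one_le_coeffNorm (h.det i)
    set v := coeffNorm (toReal (V i)) with hv
    set y := V i * altMat N i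
    -- The relation for `x` turns this integer into a combination of approximation errors, which is
    -- eventually less than `1` in absolute value.
    rw [← Int.abs_lt_one_iff]
    have e : (r * y 0 0 + q * y 0 1 + p * y 1 1 : ℝ) =
        -(q * (y 0 0 * x - y 0 1) + p * (y 0 0 * x ^ 2 - y 1 1)) := by
      linear_combination (y 0 0 : ℝ) * hx
    have : |(r * y 0 0 + q * y 0 1 + p * y 1 1 : ℝ)| < 1 := by
      rw [e, abs_neg]
      refine (abs_add_le _ _).trans_lt ?_
      rw [abs_mul, abs_mul]
      have m1 := mul_le_mul_of_nonneg_left h1 (abs_nonneg (q : ℝ))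
      have m2 := mul_le_mul_of_nonneg_left h2 (abs_nonneg (p : ℝ))
      have m3 : (|(q : ℝ)| + |(p : ℝ)|) * K * v⁻¹ < 1 := by
        rw [← div_eq_mul_inv, div_lt_one (by linarith)]
        exact hi
      linarith
    exact_mod_cast this
  obtain ⟨i, hi⟩ := eventually_atTop.1 hev
  have hs := mul_altMat_add_two h.fib h.symm i
  refine eq_zero_of_orthogonal (A := V i) (M := altMat N i) (Y := V (i + 1) * altMat N (i + 1))
    (h.det i) ?_ ?_ (h.symm i) (h.symm _) ?_ ?_
  · rw [Matrix.det_mul, altMat_det]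
    exact mul_ne_zero (h.det _) h.detN
  · unfold altMat
    split_ifs
    · rw [Matrix.transpose_transpose]
      exact h.transpose_ne.symm
    · exact h.transpose_ne
  · rw [← hs]
    exact h.symm _
  · rintro Z (rfl | rfl | rfl)
    · exact hi i le_rfl
    · exact hi (i + 1) (by omega)
    · rw [← hs]
      exact hi (i + 2) (by omega)

theorem irrational (h : Approximates x N V C) : Irrational x := by
  rintro ⟨t, rfl⟩
  have := h.eq_zero_of_quadratic (p := 0) (q := t.den) (r := -t.num) (by
    have h1 : (t.den : ℝ) ≠ 0 := by exact_mod_cast t.den_nz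
    have h2 : (t : ℝ) = t.num / t.den := by exact_mod_cast (Rat.num_div_den t).symm
    rw [h2]
    push_cast
    field_simp
    ring)
  exact t.den_nz (by exact_mod_cast this.2.1)

/-- For `K X_i ≤ Y < K X_{i+1}` the point of index `i` works: its error is `≪ X_i⁻¹`, and `Y ≪ X_i ^
γ` bounds this by `Y ^ (-1/γ)`. The constant `c1` covers `Y < K X_0` through the triple `(1, 0, 0)`.
-/
theorem isExtremal (h : Approximates x N V C) {D : ℝ} (hD : 0 < D)
    (hgrow : ∀ i, coeffNorm (toReal (V (i + 1))) ≤
      D * coeffNorm (toReal (V i)) ^ Real.goldenRatio) : IsExtremal x := by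
  have hg := Real.goldenRatio_pos
  refine ⟨h.irrational, fun p q r hp hx => hp (h.eq_zero_of_quadratic hx).1, ?_⟩
  obtain ⟨K, hK, hb⟩ := h.point_bound
  set X : ℕ → ℝ := fun i => coeffNorm (toReal (V i)) with hX
  have hX1 : ∀ i, 1 ≤ X i := fun i => one_le_coeffNorm (h.det i)
  have hX0 : ∀ i, 0 < X i := fun i => by linarith [hX1 i]
  set c1 := (|x| + x ^ 2) * (K * X 0) ^ (1 / Real.goldenRatio) with hc1
  set c2 := K * (K * D) ^ (1 / Real.goldenRatio) with hc2
  have hc1' : 0 ≤ c1 := by have := hX0 0; positivity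
  have hc2' : 0 < c2 := by positivity
  refine ⟨c1 + c2, by positivity, fun Y hY => ?_⟩
  have hY0 : 0 < Y := by linarith
  have hYp : 0 < Y ^ (-(1 / Real.goldenRatio)) := by positivity
  have hex : ∃ i, Y < K * X i := by
    obtain ⟨i, hi⟩ := (h.tendsto.eventually_gt_atTop (Y / K)).exists
    exact ⟨i, by rwa [div_lt_iff₀' hK] at hi⟩
  have hcase : Y < K * X 0 ∨ ∃ i, K * X i ≤ Y ∧ Y < K * X (i + 1) := by
    classical
    rcases hfind : Nat.find hex with _ | i
    · left
      have := Nat.find_spec hex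
      rwa [hfind] at this
    · right
      refine ⟨i, ?_, ?_⟩
      · exact not_lt.1 (Nat.find_min hex (by omega))
      · have := Nat.find_spec hex
        rwa [hfind] at this
  rcases hcase with h0 | ⟨i, hi1, hi2⟩
  · have h1 : 1 ≤ (K * X 0) ^ (1 / Real.goldenRatio) * Y ^ (-(1 / Real.goldenRatio)) := by
      rw [Real.rpow_neg hY0.le, ← div_eq_mul_inv, one_le_div (by positivity)]
      exact Real.rpow_le_rpow hY0.le h0.le (by positivity)
    have h2 : |x| + x ^ 2 ≤ c1 * Y ^ (-(1 / Real.goldenRatio)) := by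
      rw [hc1, mul_assoc]
      exact le_mul_of_one_le_right (by positivity) h1
    have h3 := mul_pos hc2' hYp
    refine ⟨1, 0, 0, by simp, by simpa using hY, ?_, ?_⟩
    · simp only [Int.cast_one, Int.cast_zero, one_mul, sub_zero]
      nlinarith [sq_nonneg x]
    · simp only [Int.cast_one, Int.cast_zero, one_mul, sub_zero]
      rw [abs_of_nonneg (sq_nonneg x)]
      nlinarith [abs_nonneg x]
  · obtain ⟨b1, b2, b3⟩ := hb i
    have h1 : (X i)⁻¹ ≤ (K * D) ^ (1 / Real.goldenRatio) * Y ^ (-(1 / Real.goldenRatio)) := by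
      have h2 : Y ≤ K * D * X i ^ Real.goldenRatio := by
        have := mul_le_mul_of_nonneg_left (hgrow i) hK.le
        linarith
      have h3 := Real.rpow_le_rpow hY0.le h2 (z := 1 / Real.goldenRatio) (by positivity)
      rw [Real.mul_rpow (by positivity) (by have := hX0 i; positivity),
        ← Real.rpow_mul (hX0 i).le, mul_one_div_cancel hg.ne', Real.rpow_one] at h3
      rw [Real.rpow_neg hY0.le, ← div_eq_mul_inv, le_div_iff₀ (by positivity),
        inv_mul_le_iff₀ (hX0 i)]
      linarith
    have h2 : K * (X i)⁻¹ ≤ (c1 + c2) * Y ^ (-(1 / Real.goldenRatio)) := by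
      have := mul_le_mul_of_nonneg_left h1 hK.le
      have := mul_nonneg hc1' hYp.le
      rw [hc2]
      linarith
    refine ⟨(V i * altMat N i) 0 0, (V i * altMat N i) 0 1, (V i * altMat N i) 1 1, ?_,
      b1.trans hi1, b2.trans h2, b3.trans h2⟩
    intro h0
    simp only [Prod.mk.injEq] at h0
    have hdet : (V i * altMat N i).det = 0 := by
      rw [Matrix.det_fin_two, h0.1, h0.2.1]
      simp
    rw [Matrix.det_mul, altMat_det] at hdet
    exact mul_ne_zero (h.det i) h.detN hdet

end Approximates

/-! ### Construction of admissible Fibonacci sequences in `GL₂(ℤ)` -/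

/-- Solution of the linear system expressing the symmetry of `A Nᵀ`, `B N` and `B A Nᵀ`. -/
def symmetrizer (A B : Matrix (Fin 2) (Fin 2) ℤ) : Matrix (Fin 2) (Fin 2) ℤ :=
  (A * B - B * A) * (B * A) * !![0, 1; -1, 0]

/-- Transposing exchanges `B * A` and `A * B` in the last factor. When the commutator is invertible,
the symmetrizer is therefore symmetric only if `A B = B A`, and skew-symmetric only if `A B = -B A`.
-/
theorem symmetrizer_transpose (A B : Matrix (Fin 2) (Fin 2) ℤ) :
    (symmetrizer A B)ᵀ = (A * B - B * A) * (A * B) * !![0, 1; -1, 0] := by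
  ext i j
  fin_cases i <;> fin_cases j <;>
    simp [symmetrizer, Matrix.mul_apply, Fin.sum_univ_two] <;> ring

/-- For `J` with rows `(0, 1)` and `(-1, 0)`, the matrix `X J` is symmetric exactly when `X` has
trace `0`. The three symmetries are thus trace identities for words in `A` and `B`. -/
theorem symmetrizer_symm_left (A B : Matrix (Fin 2) (Fin 2) ℤ) :
    (A * (symmetrizer A B)ᵀ).IsSymm := by
  rw [symmetrizer_transpose]
  ext i j
  fin_cases i <;> fin_cases j <;>
    simp [Matrix.mul_apply, Fin.sum_univ_two] <;> ring

theorem symmetrizer_symm_right (A B : Matrix (Fin 2) (Fin 2) ℤ) :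
    (B * symmetrizer A B).IsSymm := by
  ext i j
  fin_cases i <;> fin_cases j <;>
    simp [symmetrizer, Matrix.mul_apply, Fin.sum_univ_two] <;> ring

theorem symmetrizer_symm_mul (A B : Matrix (Fin 2) (Fin 2) ℤ) :
    (B * A * (symmetrizer A B)ᵀ).IsSymm := by
  rw [symmetrizer_transpose]
  ext i j
  fin_cases i <;> fin_cases j <;>
    simp [Matrix.mul_apply, Fin.sum_univ_two] <;> ring

theorem symmetrizer_det (A B : Matrix (Fin 2) (Fin 2) ℤ) :
    (symmetrizer A B).det = (A * B - B * A).det * (B.det * A.det) := by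
  rw [symmetrizer, Matrix.det_mul, Matrix.det_mul, Matrix.det_mul B A]
  simp [Matrix.det_fin_two]

theorem eq_of_det_ne_zero {D X Y : Matrix (Fin 2) (Fin 2) ℤ} (hD : D.det ≠ 0)
    (h : D * X * !![0, 1; -1, 0] = D * Y * !![0, 1; -1, 0]) : X = Y := by
  have hJ : (!![0, 1; -1, 0] : Matrix (Fin 2) (Fin 2) ℤ) * !![0, -1; 1, 0] = 1 := by
    ext i j
    fin_cases i <;> fin_cases j <;> simp
  have h1 := congrArg (fun Z => Z * (!![0, -1; 1, 0] : Matrix (Fin 2) (Fin 2) ℤ)) h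
  simp only [mul_assoc, hJ, mul_one] at h1
  have h2 := congrArg (fun Z => D.adjugate * Z) h1
  simp only [← mul_assoc, Matrix.adjugate_mul, smul_mul_assoc, one_mul] at h2
  exact smul_right_injective _ hD h2

theorem symmetrizer_transpose_ne {A B : Matrix (Fin 2) (Fin 2) ℤ}
    (hD : (A * B - B * A).det ≠ 0) : (symmetrizer A B)ᵀ ≠ symmetrizer A B := by
  intro h
  rw [symmetrizer_transpose] at h
  have := eq_of_det_ne_zero hD h
  simp [this] at hD

theorem symmetrizer_transpose_ne_neg {A B : Matrix (Fin 2) (Fin 2) ℤ}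
    (hD : (A * B - B * A).det ≠ 0) (hE : A * B ≠ -(B * A)) :
    (symmetrizer A B)ᵀ ≠ -symmetrizer A B := by
  intro h
  rw [symmetrizer_transpose] at h
  refine hE (eq_of_det_ne_zero hD ?_)
  rw [h, symmetrizer, mul_neg, neg_mul]

/-- Let `D` be the commutator, so that `D` and `A D` have trace `0`. If `D` were singular and
non-zero, its first column would be an integral eigenvector of `A`, and `tr² - 4 det` would be a
square. But `T² - 4` with `T ≥ 3` and `T² + 4` with `T ≥ 1` lie strictly between squares, or would
equal a neighbouring square of the wrong parity. -/
theorem det_commutator_ne_zero {A B : Matrix (Fin 2) (Fin 2) ℤ} (hA : IsContinuant A)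
    (hdet : A.det = 1 ∨ A.det = -1) (hAB : A * B ≠ B * A) : (A * B - B * A).det ≠ 0 := by
  intro h0
  obtain ⟨D, hD⟩ : ∃ D, D = A * B - B * A := ⟨_, rfl⟩
  have htr : D 1 1 = -D 0 0 := by
    simp [hD, Matrix.mul_apply, Fin.sum_univ_two]
    ring
  have htrA : A 0 0 * D 0 0 + A 0 1 * D 1 0 + A 1 0 * D 0 1 - A 1 1 * D 0 0 = 0 := by
    simp [hD, Matrix.mul_apply, Fin.sum_univ_two]
    ring
  have hD0 : D ≠ 0 := by
    rw [hD, sub_ne_zero]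
    exact hAB
  rw [← hD, Matrix.det_fin_two, htr] at h0
  have hq : A 1 0 * D 0 0 ^ 2 + (A 1 1 - A 0 0) * D 0 0 * D 1 0 - A 0 1 * D 1 0 ^ 2 = 0 := by
    linear_combination (-D 1 0) * htrA - A 1 0 * h0
  obtain ⟨h1, h2, h3, h4, h5, h6, h7⟩ := hA
  have ha : D 0 0 ≠ 0 := by
    intro ha
    rw [ha] at hq htr htrA
    have hc : D 1 0 = 0 := by
      have : A 0 1 * D 1 0 ^ 2 = 0 := by linarith
      rcases mul_eq_zero.1 this with h | h
      · omega
      · exact pow_eq_zero_iff two_ne_zero |>.1 h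
    rw [hc] at htrA
    have hb : D 0 1 = 0 := by
      have : A 1 0 * D 0 1 = 0 := by linarith
      rcases mul_eq_zero.1 this with h | h
      · omega
      · exact h
    apply hD0
    ext i j
    fin_cases i <;> fin_cases j <;> simp [ha, hb, hc, htr]
  have hsq : ((A 0 0 + A 1 1) ^ 2 - 4 * A.det) * D 0 0 ^ 2 =
      (2 * A 0 1 * D 1 0 + (A 0 0 - A 1 1) * D 0 0) ^ 2 := by
    rw [Matrix.det_fin_two]
    linear_combination (4 * A 0 1) * hq
  obtain ⟨s, hs⟩ : D 0 0 ∣ 2 * A 0 1 * D 1 0 + (A 0 0 - A 1 1) * D 0 0 := by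
    rw [← Int.pow_dvd_pow_iff two_ne_zero]
    exact ⟨_, by rw [← hsq, mul_comm]⟩
  have hΔ : (A 0 0 + A 1 1) ^ 2 - 4 * A.det = s ^ 2 := by
    rw [hs] at hsq
    have : D 0 0 ^ 2 ≠ 0 := pow_ne_zero _ ha
    apply mul_right_cancel₀ this
    rw [hsq]
    ring
  rw [← sq_abs s] at hΔ
  have hs0 := abs_nonneg s
  generalize |s| = t at *
  generalize hT : A 0 0 + A 1 1 = T at *
  rcases hdet with hd | hd
  · have hT3 : 3 ≤ T := by
      rw [Matrix.det_fin_two] at hd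
      nlinarith
    rw [hd] at hΔ
    have : t < T := by nlinarith
    have : T - 2 < t := by nlinarith
    have : t = T - 1 := by omega
    subst this
    ring_nf at hΔ
    omega
  · have hT1 : 1 ≤ T := by omega
    rw [hd] at hΔ
    have : T < t := by nlinarith
    have : t < T + 2 := by nlinarith
    have : t = T + 1 := by omega
    subst this
    ring_nf at hΔ
    omega

theorem content_nonneg (A : Matrix (Fin 2) (Fin 2) ℤ) : 0 ≤ content A :=
  Int.nonneg_of_normalize_eq_self Finset.normalize_gcd

theorem content_eq_one_of_isUnit {A : Matrix (Fin 2) (Fin 2) ℤ} (hA : IsUnit A.det) :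
    content A = 1 := by
  have h : content A ∣ A.det := by
    rw [Matrix.det_fin_two]
    exact dvd_sub (Dvd.dvd.mul_right (content_dvd A 0 0) _)
      (Dvd.dvd.mul_right (content_dvd A 0 1) _)
  rcases Int.isUnit_iff.1 (isUnit_of_dvd_unit h hA) with h1 | h1
  · exact h1
  · have := content_nonneg A
    omega

theorem red_eq_self {A : Matrix (Fin 2) (Fin 2) ℤ} (hA : content A = 1) : red A = A := by
  ext i j
  simp [red, hA]

theorem isSymm_of_smul {c : ℤ} (hc : c ≠ 0) {A : Matrix (Fin 2) (Fin 2) ℤ}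
    (h : (c • A).IsSymm) : A.IsSymm := by
  rw [Matrix.IsSymm, Matrix.transpose_smul] at h
  exact smul_right_injective _ hc h

/-- The conditions on the first two terms of a Fibonacci sequence in `GL₂(ℤ)` that make it
admissible. -/
theorem exists_symmetrizer {V : ℕ → Matrix (Fin 2) (Fin 2) ℤ} (hV : IsFibonacci V)
    (h0 : (V 0).det ≠ 0) (h1 : (V 1).det ≠ 0) (hD : (V 0 * V 1 - V 1 * V 0).det ≠ 0)
    (hE : V 0 * V 1 ≠ -(V 1 * V 0)) :
    ∃ N : PrimMat, N.1ᵀ ≠ N.1 ∧ N.1ᵀ ≠ -N.1 ∧ ∀ i, (V i * altMat N.1 i).IsSymm := by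
  set S := symmetrizer (V 0) (V 1) with hS
  have hSd : S.det ≠ 0 := by
    rw [hS, symmetrizer_det]
    exact mul_ne_zero hD (mul_ne_zero h1 h0)
  have hc : content S ≠ 0 := by
    intro hc
    have := content_smul_red S
    rw [hc, zero_smul] at this
    rw [← this] at hSd
    simp at hSd
  have hred := content_smul_red S
  refine ⟨⟨red S, content_red hSd, det_red_ne_zero hSd⟩, ?_, ?_, ?_⟩
  · intro h
    apply symmetrizer_transpose_ne hD
    rw [← hS, ← hred, Matrix.transpose_smul]
    exact congrArg _ h
  · intro h
    apply symmetrizer_transpose_ne_neg hD hE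
    rw [← hS, ← hred, Matrix.transpose_smul, ← smul_neg]
    exact congrArg _ h
  · have hT : content S • (red S)ᵀ = Sᵀ := by rw [← Matrix.transpose_smul, hred]
    refine isSymm_mul_of_isSymm hV ?_ ?_ ?_
    · refine isSymm_of_smul hc ?_
      simp only [altMat, Even.zero, if_true, ← mul_smul_comm, hT]
      exact symmetrizer_symm_left _ _
    · refine isSymm_of_smul hc ?_
      simp only [altMat, Nat.not_even_one, if_false, ← mul_smul_comm, hred]
      exact symmetrizer_symm_right _ _
    · refine isSymm_of_smul hc ?_
      simp only [altMat, even_two, if_true, ← mul_smul_comm, hT]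
      rw [hV 0]
      exact symmetrizer_symm_mul _ _

/-! ### Growth of a Fibonacci sequence -/

/-- Since `γ² = γ + 1`, the quantity `d i = log p (i + 1) - γ log p i` satisfies `d (i + 1) = -(γ -
1) d i + e` with `0 ≤ e ≤ log 2`. As `γ - 1 < 1`, it stays bounded. -/
theorem abs_log_sub_le {p : ℕ → ℝ} (hp : ∀ i, 1 ≤ p i) (h1 : ∀ i, p (i + 1) * p i ≤ p (i + 2))
    (h2 : ∀ i, p (i + 2) ≤ 2 * (p (i + 1) * p i)) :
    ∃ K : ℝ, ∀ i, |Real.log (p (i + 1)) - Real.goldenRatio * Real.log (p i)| ≤ K := by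
  have hg := Real.one_lt_goldenRatio
  have hg2 := Real.goldenRatio_sq
  have hlt2 := Real.goldenRatio_lt_two
  generalize Real.goldenRatio = g at *
  set d : ℕ → ℝ := fun i => Real.log (p (i + 1)) - g * Real.log (p i) with hd
  have hlog2 := Real.log_pos one_lt_two
  have hpos : ∀ i, 0 < p i := fun i => by linarith [hp i]
  have hstep : ∀ i, |d (i + 1)| ≤ (g - 1) * |d i| + Real.log 2 := by
    intro i
    have l1 := Real.log_le_log (mul_pos (hpos (i + 1)) (hpos i)) (h1 i)
    have l2 := Real.log_le_log (hpos _) (h2 i)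
    have hm := mul_pos (hpos (i + 1)) (hpos i)
    rw [Real.log_mul (by norm_num) hm.ne'] at l2
    rw [Real.log_mul (hpos _).ne' (hpos _).ne'] at l1 l2
    have e : d (i + 1) = -((g - 1) * d i) +
        (Real.log (p (i + 2)) - (Real.log (p (i + 1)) + Real.log (p i))) := by
      simp only [hd]
      linear_combination (-Real.log (p i)) * hg2
    rw [e]
    refine (abs_add_le _ _).trans ?_
    rw [abs_neg, abs_mul, abs_of_pos (by linarith : 0 < g - 1)]
    have : |Real.log (p (i + 2)) - (Real.log (p (i + 1)) + Real.log (p i))| ≤ Real.log 2 := by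
      rw [abs_le]
      constructor <;> linarith
    linarith
  have hg' : 0 < 2 - g := by linarith
  refine ⟨max |d 0| (Real.log 2 / (2 - g)), fun i => ?_⟩
  change |d i| ≤ _
  set K := max |d 0| (Real.log 2 / (2 - g)) with hK
  have hK2 : Real.log 2 ≤ K * (2 - g) := by
    rw [← div_le_iff₀ hg']
    exact le_max_right _ _
  induction i with
  | zero => exact le_max_left _ _
  | succ i ih =>
    have := mul_le_mul_of_nonneg_left ih (by linarith : 0 ≤ g - 1)
    linarith [hstep i]

theorem exists_pow_goldenRatio_bounds {p : ℕ → ℝ} (hp : ∀ i, 1 ≤ p i)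
    (h1 : ∀ i, p (i + 1) * p i ≤ p (i + 2)) (h2 : ∀ i, p (i + 2) ≤ 2 * (p (i + 1) * p i)) :
    ∃ L : ℝ, 0 < L ∧ ∀ i, p (i + 1) ≤ L * p i ^ Real.goldenRatio ∧
      p i ^ Real.goldenRatio ≤ L * p (i + 1) := by
  obtain ⟨K, hK⟩ := abs_log_sub_le hp h1 h2
  refine ⟨Real.exp K, Real.exp_pos K, fun i => ?_⟩
  have hpos : ∀ i, 0 < p i := fun i => by linarith [hp i]
  obtain ⟨k1, k2⟩ := abs_le.1 (hK i)
  have hr : p i ^ Real.goldenRatio = Real.exp (Real.goldenRatio * Real.log (p i)) := by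
    rw [Real.rpow_def_of_pos (hpos i), mul_comm]
  have hl : p (i + 1) = Real.exp (Real.log (p (i + 1))) := (Real.exp_log (hpos _)).symm
  rw [hr, hl, ← Real.exp_add, ← Real.exp_add]
  constructor
  · exact Real.exp_le_exp.2 (by linarith)
  · exact Real.exp_le_exp.2 (by linarith)

/-! ### Conjugates of continued fraction matrices -/

theorem coeffNorm_wordMat {A : Matrix (Fin 2) (Fin 2) ℤ} (hA : IsContinuant A) :
    coeffNorm (toReal A) = A 0 0 := by
  obtain ⟨h1, h2, h3, h4, h5, h6, h7⟩ := hA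
  have h0 : (0 : ℝ) ≤ A 0 0 := by
    have : 0 ≤ A 0 0 := by omega
    exact_mod_cast this
  apply le_antisymm
  · refine coeffNorm_le h0 fun i j => ?_
    simp only [toReal, Matrix.map_apply]
    rw [← Int.cast_abs]
    norm_cast
    fin_cases i <;> fin_cases j <;> simp <;> rw [abs_of_nonneg] <;> omega
  · have := abs_le_coeffNorm (toReal A) 0 0
    simp only [toReal, Matrix.map_apply] at this
    rwa [abs_of_nonneg h0] at this

/-- A matrix with inverse `Q` that maps the row `(x, -1)` to a multiple of `(1, -y)`. -/
structure RowRel (x y : ℝ) (P Q : Matrix (Fin 2) (Fin 2) ℤ) (c : ℝ) : Prop where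
  mul_eq : P * Q = 1
  mul_eq' : Q * P = 1
  row : !![x, -1] * toReal P = c • !![1, -y]
  ne_zero : c ≠ 0

/-- The exchange of coordinates only reconciles the normalisations `(x, -1)` and `(1, -x)`. -/
theorem RowRel.refl (x : ℝ) : RowRel x x !![0, 1; 1, 0] !![0, 1; 1, 0] (-1) := by
  refine ⟨?_, ?_, ?_, by norm_num⟩
  · ext i j
    fin_cases i <;> fin_cases j <;> simp
  · ext i j
    fin_cases i <;> fin_cases j <;> simp
  · ext i j
    fin_cases i
    fin_cases j <;> simp [toReal, Matrix.mul_apply, Fin.sum_univ_two]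

theorem quotMat_mul_inv (b : ℤ) : quotMat b * !![0, 1; 1, -b] = 1 := by
  ext i j
  fin_cases i <;> fin_cases j <;> simp [quotMat]

theorem inv_mul_quotMat (b : ℤ) : !![0, 1; 1, -b] * quotMat b = 1 := by
  ext i j
  fin_cases i <;> fin_cases j <;> simp [quotMat]

theorem row_mul_quotMat {b : ℤ} {y z : ℝ} (hz : z ≠ 0) (hy : y = b + 1 / z) :
    !![1, -y] * toReal (quotMat b) = (-(1 / z)) • !![1, -z] := by
  ext i j
  fin_cases i
  fin_cases j
  · simp [toReal, quotMat, Matrix.mul_apply, Fin.sum_univ_two, hy]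
  · simp [toReal, quotMat, Matrix.mul_apply, Fin.sum_univ_two, hz]

theorem RowRel.mul_quotMat {x y z : ℝ} {P Q : Matrix (Fin 2) (Fin 2) ℤ} {c : ℝ}
    (h : RowRel x y P Q c) {b : ℤ} (hz : z ≠ 0) (hy : y = b + 1 / z) :
    RowRel x z (P * quotMat b) (!![0, 1; 1, -b] * Q) (c * -(1 / z)) := by
  refine ⟨?_, ?_, ?_, mul_ne_zero h.ne_zero (neg_ne_zero.2 (one_div_ne_zero hz))⟩
  · rw [mul_assoc, ← mul_assoc (quotMat b), quotMat_mul_inv, one_mul, h.mul_eq]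
  · rw [mul_assoc, ← mul_assoc Q, h.mul_eq', one_mul, inv_mul_quotMat]
  · rw [toReal_mul, ← Matrix.mul_assoc, h.row, Matrix.smul_mul, row_mul_quotMat hz hy, smul_smul]

theorem RowRel.mul_quotMat_inv {x y z : ℝ} {P Q : Matrix (Fin 2) (Fin 2) ℤ} {c : ℝ}
    (h : RowRel x z P Q c) {b : ℤ} (hz : z ≠ 0) (hy : y = b + 1 / z) :
    RowRel x y (P * !![0, 1; 1, -b]) (quotMat b * Q) (c * -z) := by
  refine ⟨?_, ?_, ?_, mul_ne_zero h.ne_zero (neg_ne_zero.2 hz)⟩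
  · rw [mul_assoc, ← mul_assoc !![0, 1; 1, -b], inv_mul_quotMat, one_mul, h.mul_eq]
  · rw [mul_assoc, ← mul_assoc Q, h.mul_eq', one_mul, quotMat_mul_inv]
  · have e : !![1, -z] = (-z) • (!![1, -y] * toReal (quotMat b)) := by
      rw [row_mul_quotMat hz hy, smul_smul, neg_mul_neg, mul_one_div_cancel hz, one_smul]
    rw [toReal_mul, ← Matrix.mul_assoc, h.row, e, Matrix.smul_mul, Matrix.smul_mul, Matrix.mul_assoc,
      ← toReal_mul, quotMat_mul_inv, toReal_one, Matrix.mul_one, smul_smul]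

theorem exists_rowRel_completeQuotient {x : ℝ}
    (hx : ∀ n, Int.fract (completeQuotient x n) ≠ 0) (n : ℕ) :
    ∃ P Q c, RowRel x (completeQuotient x n) P Q c := by
  induction n with
  | zero => exact ⟨_, _, _, RowRel.refl x⟩
  | succ n ih =>
    obtain ⟨P, Q, c, h⟩ := ih
    rw [completeQuotient_succ']
    exact ⟨_, _, _, h.mul_quotMat (inv_ne_zero (hx n)) (eq_floor_add_inv _)⟩

theorem RowRel.det_ne_zero {x y : ℝ} {P Q : Matrix (Fin 2) (Fin 2) ℤ} {c : ℝ}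
    (h : RowRel x y P Q c) : P.det ≠ 0 ∧ Q.det ≠ 0 := by
  have := congrArg Matrix.det h.mul_eq
  rw [Matrix.det_mul, Matrix.det_one] at this
  constructor <;> intro h0 <;> simp [h0] at this

/-! ### Complete quotients of an infinite word -/

/-- The sequence `s` is a sequence of complete quotients of the infinite word `a`. -/
def IsQuotientSeq (a : ℕ → ℕ+) (s : ℕ → ℝ) : Prop :=
  ∀ n, 1 < s n ∧ s n = (a n : ℕ) + 1 / s (n + 1)

theorem exists_quotientSeq_of_agree {x : ℝ} {a : ℕ → ℕ+} (h : PartialQuotientsAgree x a) :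
    ∃ s P Q c, IsQuotientSeq a s ∧ RowRel x (s 0) P Q c := by
  obtain ⟨k, l, h⟩ := h
  have hfr : ∀ n, Int.fract (completeQuotient x n) ≠ 0 := by
    refine fract_completeQuotient_ne_zero fun n => ⟨k + n, by omega, ?_⟩
    rw [h]
    simp
  have hfl : ∀ i, ⌊completeQuotient x (k + i)⌋ = (a (l + i) : ℕ) := by
    intro i
    have h1 := h i
    have h2 := partialQuotient_add (x := x) (n := k + i) (fun m _ => hfr m) 0
    rw [add_zero, partialQuotient_zero, h1, Option.some_inj] at h2
    exact_mod_cast h2.symm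
  have base : ∃ s P Q c, IsQuotientSeq (fun i => a (l + i)) s ∧ RowRel x (s 0) P Q c := by
    obtain ⟨P, Q, c, hP⟩ := exists_rowRel_completeQuotient hfr k
    refine ⟨fun i => completeQuotient x (k + i), P, Q, c, fun n => ⟨?_, ?_⟩, hP⟩
    · have h1 : 1 ≤ ⌊completeQuotient x (k + n)⌋ := by
        rw [hfl]
        exact_mod_cast (a (l + n)).pos
      have h2 : (1 : ℝ) ≤ ⌊completeQuotient x (k + n)⌋ := by exact_mod_cast h1
      have h3 := (Int.fract_nonneg (completeQuotient x (k + n))).lt_of_ne' (hfr _)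
      have := Int.floor_add_fract (completeQuotient x (k + n))
      linarith
    · have := eq_floor_add_inv (completeQuotient x (k + n))
      rw [hfl, ← completeQuotient_succ'] at this
      exact_mod_cast this
  -- The complete quotients of `x` only match `a` from index `l` on. The missing letters are put
  -- back one at a time, each changing `P` by an elementary matrix.
  clear h hfl
  induction l with
  | zero => simpa using base
  | succ l ih =>
    apply ih
    obtain ⟨s, P, Q, c, hs, hP⟩ := base
    have hs0 : s 0 ≠ 0 := by linarith [(hs 0).1]
    have ha : (1 : ℝ) ≤ (a l : ℕ) := by exact_mod_cast (a l).pos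
    refine ⟨fun n => Nat.casesOn n ((a l : ℕ) + 1 / s 0) s, _, _, _, fun n => ?_,
      hP.mul_quotMat_inv (b := (a l : ℕ)) hs0 (by push_cast; rfl)⟩
    cases n with
    | zero =>
      have : 0 < 1 / s 0 := by have := (hs 0).1; positivity
      have h1 : 1 < ((a l : ℕ) : ℝ) + 1 / s 0 := by linarith
      exact ⟨h1, rfl⟩
    | succ n =>
      have := hs n
      simp only [] at this
      rw [show l + 1 + n = l + (n + 1) by ring] at this
      exact this

/-- In vector form, `wordMat u` sends `(s n, 1)ᵗ`, with `n` the length of `u`, to `r (s 0, 1)ᵗ`; one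
letter accounts for one step of the expansion. -/
theorem exists_wordMat_mul_quotient {a : ℕ → ℕ+} {s : ℕ → ℝ} (hs : IsQuotientSeq a s)
    {u : List ℕ+} (hu : OccursAt a 0 u) :
    ∃ r : ℝ, 0 < r ∧ wordMat u 0 0 * s u.length + wordMat u 0 1 = r * s 0 ∧
      wordMat u 1 0 * s u.length + wordMat u 1 1 = r := by
  induction u generalizing a s with
  | nil => exact ⟨1, one_pos, by simp [wordMat], by simp [wordMat]⟩
  | cons b u ih =>
    obtain ⟨r, hr, h1, h2⟩ := ih (a := fun n => a (n + 1)) (s := fun n => s (n + 1))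
      (fun n => hs (n + 1)) (by
        intro t ht
        have := hu (t + 1) (by simpa using ht)
        simpa using this)
    have hb : b = a 0 := by simpa using hu 0 (by simp)
    have h01 := (hs 1).1
    have hs0 := (hs 0).2
    refine ⟨r * s 1, by positivity, ?_, ?_⟩
    · rw [wordMat, quotMat_mul, hs0, hb]
      simp
      simp at h1 h2
      have : s 1 ≠ 0 := by positivity
      field_simp
      linear_combination (a 0 : ℝ) * h1 + h2
    · rw [wordMat, quotMat_mul]
      simpa using h1

theorem coeffNorm_row_mul_wordMat_le {a : ℕ → ℕ+} {s : ℕ → ℝ} (hs : IsQuotientSeq a s)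
    {u : List ℕ+} (hu0 : u ≠ []) (hu : OccursAt a 0 u) :
    coeffNorm (!![1, -s 0] * toReal (wordMat u)) ≤ s 0 / wordMat u 0 0 := by
  obtain ⟨r, hr, h1, h2⟩ := exists_wordMat_mul_quotient hs hu
  have hc := wordMat_isContinuant_of_ne_nil hu0
  have hp : (1 : ℝ) ≤ wordMat u 0 0 := by exact_mod_cast hc.pos01.trans hc.le01'
  have hp' : (0 : ℝ) ≤ wordMat u 0 1 := by exact_mod_cast zero_le_one.trans hc.pos01
  have hs0 := (hs 0).1
  have hsn := (hs u.length).1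
  have hdet : |((wordMat u).det : ℝ)| = 1 := by
    rcases wordMat_det u with h | h <;> simp [h]
  rw [Matrix.det_fin_two] at hdet
  push_cast at hdet
  set p : ℝ := ((wordMat u 0 0 : ℤ) : ℝ)
  set p' : ℝ := ((wordMat u 0 1 : ℤ) : ℝ)
  set q : ℝ := ((wordMat u 1 0 : ℤ) : ℝ)
  set q' : ℝ := ((wordMat u 1 1 : ℤ) : ℝ)
  set t := s u.length
  -- From `r * s 0 = p * t + p' ≥ p * t`. Since the determinant is `±1`, Cramer's rule gives the two
  -- entries of the row the absolute values `1 / r` and `t / r`.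
  have hbd : t / r ≤ s 0 / p := by
    rw [div_le_div_iff₀ hr (by positivity)]
    linarith
  have e0 : p - s 0 * q = (p * q' - p' * q) / r := by
    rw [eq_div_iff hr.ne']
    linear_combination (-p) * h2 + q * h1
  have e1 : p' - s 0 * q' = -((p * q' - p' * q) * t / r) := by
    rw [← neg_div, eq_div_iff hr.ne']
    linear_combination (-p') * h2 + q' * h1
  refine coeffNorm_le (by positivity) fun i j => ?_
  fin_cases i
  fin_cases j
  · have : (!![1, -s 0] * toReal (wordMat u)) 0 0 = p - s 0 * q := by
      simp [Matrix.mul_apply, Fin.sum_univ_two, toReal, p, q]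
      ring
    simp only [Fin.zero_eta, this]
    rw [e0, abs_div, hdet, abs_of_pos hr]
    refine le_trans ?_ hbd
    gcongr
  · have : (!![1, -s 0] * toReal (wordMat u)) 0 1 = p' - s 0 * q' := by
      simp [Matrix.mul_apply, Fin.sum_univ_two, toReal, p', q']
      ring
    simp only [Fin.zero_eta, Fin.mk_one, this]
    rw [e1, abs_neg, abs_div, abs_mul, hdet, abs_of_pos hr, one_mul, abs_of_pos (by linarith)]
    exact hbd

/-- The lower bound for `‖(x, -1) A‖` when `|det A| = 1`. -/
theorem one_le_mul_coeffNorm_row (x : ℝ) {A : Matrix (Fin 2) (Fin 2) ℤ} (hA : IsUnit A.det) :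
    1 ≤ 2 * coeffNorm (toReal A) * coeffNorm (!![x, -1] * toReal A) := by
  have hdet : |(A.det : ℝ)| = 1 := by
    rcases Int.isUnit_iff.1 hA with h | h <;> simp [h]
  rw [Matrix.det_fin_two] at hdet
  push_cast at hdet
  have n0 := abs_le_coeffNorm (toReal A) 0 0
  have n1 := abs_le_coeffNorm (toReal A) 0 1
  have r0 := abs_le_coeffNorm (!![x, -1] * toReal A) 0 0
  have r1 := abs_le_coeffNorm (!![x, -1] * toReal A) 0 1
  have hn := coeffNorm_nonneg (toReal A)
  have hr := coeffNorm_nonneg (!![x, -1] * toReal A)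
  set n := coeffNorm (toReal A)
  set ρ := coeffNorm (!![x, -1] * toReal A)
  have e0 : (!![x, -1] * toReal A) 0 0 = x * A 0 0 - A 1 0 := by
    simp [Matrix.mul_apply, Fin.sum_univ_two, toReal]
    ring
  have e1 : (!![x, -1] * toReal A) 0 1 = x * A 0 1 - A 1 1 := by
    simp [Matrix.mul_apply, Fin.sum_univ_two, toReal]
    ring
  rw [e0] at r0
  rw [e1] at r1
  simp only [toReal, Matrix.map_apply] at n0 n1
  rw [← hdet]
  have e : (A 0 0 * A 1 1 - A 0 1 * A 1 0 : ℝ) =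
      (x * A 0 0 - A 1 0) * A 0 1 - A 0 0 * (x * A 0 1 - A 1 1) := by ring
  rw [e]
  refine (abs_sub _ _).trans ?_
  rw [abs_mul, abs_mul]
  have m1 := mul_le_mul r0 n1 (abs_nonneg _) hr
  have m2 := mul_le_mul n0 r1 (abs_nonneg _) hn
  linarith

theorem wordMat_fib_bounds {u v : List ℕ+} (hu : u ≠ []) (hv : v ≠ []) :
    (wordMat u 0 0 : ℝ) * wordMat v 0 0 ≤ wordMat (u ++ v) 0 0 ∧
      (wordMat (u ++ v) 0 0 : ℝ) ≤ 2 * (wordMat u 0 0 * wordMat v 0 0) ∧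
      wordMat u 0 0 + 1 ≤ wordMat (u ++ v) 0 0 := by
  obtain ⟨a1, a2, a3, a4, a5, a6, a7⟩ := wordMat_isContinuant_of_ne_nil hu
  obtain ⟨b1, b2, b3, b4, b5, b6, b7⟩ := wordMat_isContinuant_of_ne_nil hv
  have e : wordMat (u ++ v) 0 0 =
      wordMat u 0 0 * wordMat v 0 0 + wordMat u 0 1 * wordMat v 1 0 := by
    rw [wordMat_append, Matrix.mul_apply, Fin.sum_univ_two]
  have m1 := mul_le_mul a4 b5 (by omega) (by omega)
  have m2 : 1 * 1 ≤ wordMat u 0 1 * wordMat v 1 0 := mul_le_mul a6 b7 (by omega) (by omega)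
  have m3 : wordMat u 0 0 * 1 ≤ wordMat u 0 0 * wordMat v 0 0 :=
    mul_le_mul_of_nonneg_left (by omega) (by omega)
  refine ⟨?_, ?_, by omega⟩
  · norm_cast
    omega
  · norm_cast
    omega

theorem inner_conj_mul {P Q : Matrix (Fin 2) (Fin 2) ℤ} (h : Q * P = 1)
    (A B : Matrix (Fin 2) (Fin 2) ℤ) : P * A * Q * (P * B * Q) = P * (A * B) * Q := by
  calc P * A * Q * (P * B * Q) = P * A * (Q * P) * B * Q := by simp only [mul_assoc]
    _ = _ := by rw [h]; simp only [mul_assoc, one_mul]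

theorem inner_conj_cancel {P Q : Matrix (Fin 2) (Fin 2) ℤ} (h : Q * P = 1)
    (A : Matrix (Fin 2) (Fin 2) ℤ) : Q * (P * A * Q) * P = A := by
  calc Q * (P * A * Q) * P = (Q * P) * A * (Q * P) := by simp only [mul_assoc]
    _ = _ := by rw [h, one_mul, mul_one]

theorem coeffNorm_conj_le (P Q A : Matrix (Fin 2) (Fin 2) ℤ) :
    coeffNorm (toReal (P * A * Q)) ≤
      4 * coeffNorm (toReal P) * coeffNorm (toReal Q) * coeffNorm (toReal A) := by
  rw [toReal_mul, toReal_mul]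
  have h1 := coeffNorm_mul_le (toReal P * toReal A) (toReal Q)
  have h2 := coeffNorm_mul_le (toReal P) (toReal A)
  have h3 := mul_le_mul_of_nonneg_right h2 (coeffNorm_nonneg (toReal Q))
  linarith

/-- A real number whose complete quotients are eventually those of the limit of a non-commuting
Fibonacci sequence of words is extremal, with an associated sequence in `GL₂(ℤ)`. -/
theorem exists_isAssociated {u : ℕ → List ℕ+} (hu : ∀ i, u (i + 2) = u (i + 1) ++ u i)
    (hcomm : u 0 ++ u 1 ≠ u 1 ++ u 0) {a : ℕ → ℕ+} (ha : ∀ i, OccursAt a 0 (u i)) {s : ℕ → ℝ}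
    (hs : IsQuotientSeq a s) {x : ℝ} {P Q : Matrix (Fin 2) (Fin 2) ℤ} {c : ℝ}
    (hP : RowRel x (s 0) P Q c) :
    IsExtremal x ∧ ∃ W : ℕ → PrimMat, IsAssociated W x ∧ ∀ i, IsUnit (W i).1 := by
  have hne := fib_ne_nil hu hcomm
  have hcont : ∀ i, IsContinuant (wordMat (u i)) := fun i => wordMat_isContinuant_of_ne_nil (hne i)
  set p : ℕ → ℝ := fun i => wordMat (u i) 0 0 with hp
  have hp1 : ∀ i, 1 ≤ p i := fun i => by
    have := (hcont i).pos01.trans (hcont i).le01'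
    simp only [hp]
    exact_mod_cast this
  have hp0 : ∀ i, 0 < p i := fun i => by linarith [hp1 i]
  have hb : ∀ i, p (i + 1) * p i ≤ p (i + 2) ∧ p (i + 2) ≤ 2 * (p (i + 1) * p i) ∧
      p (i + 1) + 1 ≤ p (i + 2) := by
    intro i
    have := wordMat_fib_bounds (hne (i + 1)) (hne i)
    rw [← hu i] at this
    refine ⟨this.1, this.2.1, ?_⟩
    have h3 := this.2.2
    simp only [hp]
    exact_mod_cast h3
  obtain ⟨L, hL, hLb⟩ := exists_pow_goldenRatio_bounds hp1 (fun i => (hb i).1) fun i => (hb i).2.1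
  set V : ℕ → Matrix (Fin 2) (Fin 2) ℤ := fun i => P * wordMat (u i) * Q with hVdef
  have hV : IsFibonacci V := by
    intro i
    simp only [hVdef, inner_conj_mul hP.mul_eq', hu i, wordMat_append]
  have hPQ : P.det * Q.det = 1 := by rw [← Matrix.det_mul, hP.mul_eq, Matrix.det_one]
  have hdet : ∀ i, (V i).det = (wordMat (u i)).det := by
    intro i
    simp only [hVdef, Matrix.det_mul]
    linear_combination (wordMat (u i)).det * hPQ
  have hunit : ∀ i, IsUnit (V i).det := by
    intro i
    rw [hdet, Int.isUnit_iff]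
    exact wordMat_det _
  have hD : (V 0 * V 1 - V 1 * V 0).det ≠ 0 := by
    have e : V 0 * V 1 - V 1 * V 0 =
        P * (wordMat (u 0) * wordMat (u 1) - wordMat (u 1) * wordMat (u 0)) * Q := by
      simp only [hVdef, inner_conj_mul hP.mul_eq', mul_sub, sub_mul]
    rw [e, Matrix.det_mul, Matrix.det_mul]
    refine mul_ne_zero (mul_ne_zero hP.det_ne_zero.1 ?_) hP.det_ne_zero.2
    refine det_commutator_ne_zero (hcont 0) (wordMat_det _) fun h => hcomm ?_
    rw [← wordMat_append, ← wordMat_append] at h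
    exact wordMat_injective h
  have hE : V 0 * V 1 ≠ -(V 1 * V 0) := by
    intro h
    have e : wordMat (u 0 ++ u 1) = -wordMat (u 1 ++ u 0) := by
      have h1 := congrArg (fun Z => Q * Z * P) h
      simpa only [hVdef, inner_conj_mul hP.mul_eq', inner_conj_cancel hP.mul_eq', mul_neg, neg_mul,
        ← wordMat_append] using h1
    have h1 := (wordMat_isContinuant_of_ne_nil
      (show u 0 ++ u 1 ≠ [] by simp [hne 0])).pos01
    have h2 := (wordMat_isContinuant_of_ne_nil
      (show u 1 ++ u 0 ≠ [] by simp [hne 0])).pos01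
    rw [e, Matrix.neg_apply] at h1
    omega
  obtain ⟨N, hN1, hN2, hNs⟩ := exists_symmetrizer hV (hunit 0).ne_zero (hunit 1).ne_zero hD hE
  have hPn := one_le_coeffNorm hP.det_ne_zero.1
  have hQn := one_le_coeffNorm hP.det_ne_zero.2
  -- Conjugation by `P` or by its inverse changes the norm by a factor at most `k`, so `X` and `p`
  -- are comparable.
  obtain ⟨k, hk⟩ : ∃ k, k = 4 * coeffNorm (toReal P) * coeffNorm (toReal Q) := ⟨_, rfl⟩
  have hk0 : 0 < k := by rw [hk]; positivity
  have hX1 : ∀ i, coeffNorm (toReal (V i)) ≤ k * p i := by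
    intro i
    have := coeffNorm_conj_le P Q (wordMat (u i))
    rwa [← hk, coeffNorm_wordMat (hcont i)] at this
  have hX2 : ∀ i, p i ≤ k * coeffNorm (toReal (V i)) := by
    intro i
    have := coeffNorm_conj_le Q P (V i)
    rw [inner_conj_cancel hP.mul_eq', coeffNorm_wordMat (hcont i)] at this
    rw [hk]
    linarith
  have hXp : ∀ i, 1 ≤ coeffNorm (toReal (V i)) := fun i => one_le_coeffNorm (hunit i).ne_zero
  set X : ℕ → ℝ := fun i => coeffNorm (toReal (V i)) with hX
  have hX0 : ∀ i, 0 < X i := fun i => by linarith [hXp i]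
  have hptop : Tendsto p atTop atTop := by
    rw [← tendsto_add_atTop_iff_nat 1]
    refine tendsto_atTop_mono (f := fun n : ℕ => (n : ℝ)) (fun n => ?_)
      tendsto_natCast_atTop_atTop
    induction n with
    | zero => simpa using (hp0 1).le
    | succ n ih =>
      push_cast
      have := (hb n).2.2
      linarith
  have hXtop : Tendsto X atTop atTop := by
    refine tendsto_atTop_mono (fun n => ?_) (hptop.atTop_div_const hk0)
    rw [div_le_iff₀' hk0]
    exact hX2 n
  have hg := Real.goldenRatio_pos
  have hup : ∀ i, X (i + 1) ≤ k * L * k ^ Real.goldenRatio * X i ^ Real.goldenRatio := by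
    intro i
    have h1 := Real.rpow_le_rpow (hp0 i).le (hX2 i) hg.le
    rw [Real.mul_rpow hk0.le (hX0 i).le] at h1
    calc X (i + 1) ≤ k * p (i + 1) := hX1 _
      _ ≤ k * (L * (k ^ Real.goldenRatio * X i ^ Real.goldenRatio)) := by
        gcongr
        exact (hLb i).1.trans (mul_le_mul_of_nonneg_left h1 hL.le)
      _ = _ := by ring
  have hlow : ∀ i, X i ^ Real.goldenRatio ≤ k ^ Real.goldenRatio * L * k * X (i + 1) := by
    intro i
    have h1 := Real.rpow_le_rpow (hX0 i).le (hX1 i) hg.le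
    rw [Real.mul_rpow hk0.le (hp0 i).le] at h1
    calc X i ^ Real.goldenRatio ≤ k ^ Real.goldenRatio * p i ^ Real.goldenRatio := h1
      _ ≤ k ^ Real.goldenRatio * (L * (k * X (i + 1))) := by
        gcongr
        exact (hLb i).2.trans (mul_le_mul_of_nonneg_left (hX2 _) hL.le)
      _ = _ := by ring
  have hs0 := (hs 0).1
  set C := 2 * |c| * s 0 * coeffNorm (toReal Q) * k with hC
  have hC0 : 0 < C := by
    have := abs_pos.2 hP.ne_zero
    positivity
  have hrow : ∀ i, coeffNorm (!![x, -1] * toReal (V i)) ≤ C * (X i)⁻¹ := by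
    intro i
    have h1 := coeffNorm_row_mul_wordMat_le hs (hne i) (ha i)
    have e : !![x, -1] * toReal (V i) =
        c • (!![1, -s 0] * toReal (wordMat (u i))) * toReal Q := by
      simp only [hVdef, toReal_mul]
      rw [← Matrix.mul_assoc, ← Matrix.mul_assoc, hP.row, Matrix.smul_mul]
    have h2 : coeffNorm (c • (!![1, -s 0] * toReal (wordMat (u i)))) ≤ |c| * (s 0 / p i) := by
      refine coeffNorm_le (by have := hp0 i; positivity) fun j l => ?_
      rw [Matrix.smul_apply, smul_eq_mul, abs_mul]
      exact mul_le_mul_of_nonneg_left ((abs_le_coeffNorm _ j l).trans h1) (abs_nonneg c)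
    rw [e]
    refine (coeffNorm_mul_le _ _).trans ?_
    have h3 : s 0 / p i ≤ s 0 * k * (X i)⁻¹ := by
      rw [← div_eq_mul_inv, div_le_div_iff₀ (hp0 i) (hX0 i), mul_assoc]
      exact mul_le_mul_of_nonneg_left (hX1 i) (by linarith)
    calc 2 * coeffNorm (c • (!![1, -s 0] * toReal (wordMat (u i)))) * coeffNorm (toReal Q)
        ≤ 2 * (|c| * (s 0 * k * (X i)⁻¹)) * coeffNorm (toReal Q) := by
          gcongr
          exact h2.trans (mul_le_mul_of_nonneg_left h3 (abs_nonneg c))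
      _ = _ := by rw [hC]; ring
  have happ : Approximates x N.1 V C :=
    ⟨hV, fun i => (hunit i).ne_zero, N.2.2, hN1, hNs, hC0, hrow, hXtop⟩
  refine ⟨happ.isExtremal (D := k * L * k ^ Real.goldenRatio) (by positivity) hup,
    fun i => ⟨V i, content_eq_one_of_isUnit (hunit i), (hunit i).ne_zero⟩,
    ⟨⟨?_, N, hN1, hN2, hNs⟩, ?_, ?_, ?_, ?_⟩, fun i => (Matrix.isUnit_iff_isUnit_det _).2 (hunit i)⟩
  · intro i
    apply Subtype.ext
    change V (i + 2) = red (V (i + 1) * V i)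
    rw [← hV i, red_eq_self (content_eq_one_of_isUnit (hunit _))]
  · exact Filter.not_bddAbove_of_tendsto_atTop hXtop
  · refine ⟨(k ^ Real.goldenRatio * L * k)⁻¹, _, by positivity, ?_, fun i => ⟨?_, hup i⟩⟩
    · positivity
    · rw [inv_mul_le_iff₀ (by positivity)]
      exact hlow i
  · refine ⟨1 / 2, C, by norm_num, hC0, fun i => ⟨?_, hrow i⟩⟩
    have h1 := one_le_mul_coeffNorm_row x (hunit i)
    change 1 / 2 * (X i)⁻¹ ≤ _
    rw [← div_eq_mul_inv, div_le_iff₀ (hX0 i)]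
    change 1 ≤ 2 * X i * _ at h1
    linarith
  · refine ⟨1, 1, one_pos, one_pos, fun i => ?_⟩
    have : |((V i).det : ℝ)| = 1 := by
      rcases Int.isUnit_iff.1 (hunit i) with h | h <;> simp [h]
    simp [this]

/-! ### From associated sequences to words -/

theorem completeQuotient_add (x : ℝ) (m n : ℕ) :
    completeQuotient x (m + n) = completeQuotient (completeQuotient x m) n := by
  induction n with
  | zero => rfl
  | succ n ih => rw [← add_assoc, completeQuotient_succ', completeQuotient_succ', ih]

/-- A matrix close to a large multiple of `(t, 1)ᵗ (1, -y)`, where `t > 1` and `-1 < y < 0`, has,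
up to sign, the shape of the matrix of a word. -/
theorem exists_bound_isContinuant {t y : ℝ} (ht : 1 < t) (hy : -1 < y) (hy0 : y < 0) :
    ∃ R : ℝ, ∀ A : Matrix (Fin 2) (Fin 2) ℤ, R < coeffNorm (toReal A) →
      coeffNorm (!![1, -t] * toReal A) ≤ 1 → coeffNorm (toReal A * !![y; 1]) ≤ 1 →
      IsContinuant A ∨ IsContinuant (-A) := by
  obtain ⟨z, rfl⟩ : ∃ z, y = -z := ⟨-y, by ring⟩
  have hz0 : 0 < z := by linarith
  have hz1 : 0 < 1 - z := by linarith
  have ht1 : 0 < t - 1 := by linarith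
  -- Once `A 1 0 > S`, the summands yield in turn `1 ≤ A 1 1`, `A 1 1 ≤ A 1 0`, `A 1 0 ≤ A 0 0` and
  -- `A 1 1 ≤ A 0 1`. If `0 ≤ A 1 0 ≤ S`, all entries are at most `t * (S + 1) + 1` in absolute
  -- value.
  set S := 2 / z + 1 / (1 - z) + 1 / (t - 1) + (1 / (t - 1) + 1) / z with hS
  have key : ∀ A : Matrix (Fin 2) (Fin 2) ℤ, t * (S + 1) + 1 < coeffNorm (toReal A) →
      coeffNorm (!![1, -t] * toReal A) ≤ 1 → coeffNorm (toReal A * !![-z; 1]) ≤ 1 →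
      0 ≤ A 1 0 → IsContinuant A := by
    intro A hA h1 h2 h0
    have r0 := (abs_le_coeffNorm _ 0 0).trans h1
    have r1 := (abs_le_coeffNorm _ 0 1).trans h1
    have c0 := (abs_le_coeffNorm _ 0 0).trans h2
    have c1 := (abs_le_coeffNorm _ 1 0).trans h2
    simp only [Matrix.mul_apply, Fin.sum_univ_two, toReal, Matrix.map_apply,
      Matrix.of_apply, Matrix.cons_val', Matrix.cons_val_zero, Matrix.cons_val_one,
      Matrix.cons_val_fin_one] at r0 r1 c0 c1
    rw [abs_le] at r0 r1 c0 c1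
    have h0' : (0 : ℝ) ≤ A 1 0 := by exact_mod_cast h0
    obtain ⟨r0, r0'⟩ := r0
    obtain ⟨r1, r1'⟩ := r1
    obtain ⟨c0, c0'⟩ := c0
    obtain ⟨c1, c1'⟩ := c1
    have hq : S < A 1 0 := by
      by_contra hle
      push Not at hle
      refine absurd hA (not_lt.2 ?_)
      have hS0 : 0 ≤ S := h0'.trans hle
      have hq1 : (A 1 1 : ℝ) ≤ S + 1 := by nlinarith
      have hq2 : -1 ≤ (A 1 1 : ℝ) := by nlinarith
      refine coeffNorm_le (by positivity) fun i j => ?_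
      simp only [toReal, Matrix.map_apply]
      rw [abs_le]
      fin_cases i <;> fin_cases j <;> simp <;> constructor <;> nlinarith
    have q1 : 2 / z ≤ A 1 0 := by
      refine le_trans ?_ hq.le
      have : 0 ≤ 1 / (1 - z) + 1 / (t - 1) + (1 / (t - 1) + 1) / z := by positivity
      linarith
    have q2 : 1 / (1 - z) ≤ A 1 0 := by
      refine le_trans ?_ hq.le
      have : 0 ≤ 2 / z + 1 / (t - 1) + (1 / (t - 1) + 1) / z := by positivity
      linarith
    have q3 : 1 / (t - 1) ≤ A 1 0 := by
      refine le_trans ?_ hq.le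
      have : 0 ≤ 2 / z + 1 / (1 - z) + (1 / (t - 1) + 1) / z := by positivity
      linarith
    have q4 : (1 / (t - 1) + 1) / z ≤ A 1 0 := by
      refine le_trans ?_ hq.le
      have : 0 ≤ 2 / z + 1 / (1 - z) + 1 / (t - 1) := by positivity
      linarith
    rw [div_le_iff₀ hz0] at q1 q4
    rw [div_le_iff₀ hz1] at q2
    rw [div_le_iff₀ ht1] at q3
    have q5 : 1 ≤ (A 1 1 : ℝ) * (t - 1) := by
      rw [← div_le_iff₀ ht1]
      linarith
    have e1 : (1 : ℝ) ≤ A 1 1 := by linarith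
    have e2 : (A 1 1 : ℝ) ≤ A 1 0 := by linarith
    have e3 : (A 1 0 : ℝ) ≤ A 0 0 := by linarith
    have e4 : (A 1 1 : ℝ) ≤ A 0 1 := by linarith
    have e5 : (A 0 1 : ℝ) ≤ A 0 0 := by nlinarith
    have f1 : 1 ≤ A 1 1 := by exact_mod_cast e1
    have f2 : A 1 1 ≤ A 1 0 := by exact_mod_cast e2
    have f3 : A 1 0 ≤ A 0 0 := by exact_mod_cast e3
    have f4 : A 1 1 ≤ A 0 1 := by exact_mod_cast e4
    have f5 : A 0 1 ≤ A 0 0 := by exact_mod_cast e5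
    constructor <;> omega
  have hneg : ∀ {m n : Type} [Fintype m] [Fintype n] (B : Matrix m n ℝ),
      coeffNorm (-B) = coeffNorm B := by
    intro m n _ _ B
    let _ := Matrix.normedAddCommGroup (m := m) (n := n) (α := ℝ)
    exact norm_neg B
  have hneg' : ∀ A : Matrix (Fin 2) (Fin 2) ℤ, toReal (-A) = -toReal A := by
    intro A
    ext i j
    simp [toReal]
  refine ⟨t * (S + 1) + 1, fun A hA h1 h2 => ?_⟩
  rcases le_total 0 (A 1 0) with h | h
  · exact Or.inl (key A hA h1 h2 h)
  · refine Or.inr (key (-A) ?_ ?_ ?_ (by simpa using h))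
    · rwa [hneg', hneg]
    · rwa [hneg', Matrix.mul_neg, hneg]
    · rwa [hneg', Matrix.neg_mul, hneg]

/-! ### Kernel points and their images under the continued fraction algorithm -/

/-- The number `y` such that `(1, y)ᵗ` is proportional to `M (-x, 1)ᵗ`. -/
def kernelPoint (x : ℝ) (M : Matrix (Fin 2) (Fin 2) ℤ) : ℝ :=
  (M 1 1 - x * M 1 0) / (M 0 1 - x * M 0 0)

theorem linear_ne_zero {x : ℝ} (hx : Irrational x) {a b : ℚ} (h : ¬ (a = 0 ∧ b = 0)) :
    (a : ℝ) - x * b ≠ 0 := by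
  intro h0
  by_cases hb : b = 0
  · subst hb
    simp at h0
    exact h ⟨h0, rfl⟩
  · have hb' : (b : ℝ) ≠ 0 := by exact_mod_cast hb
    refine hx ⟨a / b, ?_⟩
    push_cast
    rw [div_eq_iff hb']
    linarith

theorem kernelPoint_denom_ne_zero {x : ℝ} (hx : Irrational x) {M : Matrix (Fin 2) (Fin 2) ℤ}
    (hM : M.det ≠ 0) : (M 0 1 - x * M 0 0 : ℝ) ≠ 0 := by
  have := linear_ne_zero hx (a := M 0 1) (b := M 0 0) (by
    rintro ⟨h1, h2⟩
    have h1' : M 0 1 = 0 := by exact_mod_cast h1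
    have h2' : M 0 0 = 0 := by exact_mod_cast h2
    apply hM
    rw [Matrix.det_fin_two, h1', h2']
    ring)
  exact_mod_cast this

theorem kernelPoint_irrational {x : ℝ} (hx : Irrational x) {M : Matrix (Fin 2) (Fin 2) ℤ}
    (hM : M.det ≠ 0) : Irrational (kernelPoint x M) := by
  rintro ⟨t, ht⟩
  have hd := kernelPoint_denom_ne_zero hx hM
  rw [kernelPoint, eq_div_iff hd] at ht
  refine linear_ne_zero hx (a := M 1 1 - t * M 0 1) (b := M 1 0 - t * M 0 0) ?_ ?_
  · rintro ⟨h1, h2⟩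
    apply hM
    have : (M.det : ℚ) = 0 := by
      rw [Matrix.det_fin_two]
      push_cast
      linear_combination (M 0 0 : ℚ) * h1 - (M 0 1 : ℚ) * h2
    exact_mod_cast this
  · push_cast
    linarith

/-- Equality means `M₀₀ x² - (M₀₁ + M₁₀) x + M₁₁ = 0`, which is trivial only for skew-symmetric `M`.
-/
theorem kernelPoint_ne {x : ℝ} (hx : Irrational x)
    (hquad : ∀ p q r : ℤ, p ≠ 0 → (p : ℝ) * x ^ 2 + q * x + r ≠ 0)
    {M : Matrix (Fin 2) (Fin 2) ℤ} (hM : M.det ≠ 0) (hMt : Mᵀ ≠ -M) : kernelPoint x M ≠ x := by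
  intro h
  have hd := kernelPoint_denom_ne_zero hx hM
  rw [kernelPoint, div_eq_iff hd] at h
  have h00 : M 0 0 = 0 := by
    by_contra h0
    apply hquad (M 0 0) (-(M 0 1 + M 1 0)) (M 1 1) h0
    push_cast
    linarith
  have hlin : ¬ ¬ ((M 1 1 : ℚ) = 0 ∧ ((M 0 1 + M 1 0 : ℤ) : ℚ) = 0) := by
    intro hn
    apply linear_ne_zero hx hn
    rw [h00] at h
    push_cast at h ⊢
    linarith
  obtain ⟨h1, h2⟩ := not_not.1 hlin
  have h1' : M 1 1 = 0 := by exact_mod_cast h1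
  have h2' : M 0 1 + M 1 0 = 0 := by exact_mod_cast h2
  apply hMt
  ext i j
  fin_cases i <;> fin_cases j <;> simp <;> omega

/-- The image of `y` under the steps of the continued fraction algorithm of `x`. -/
def followQuotients (x y : ℝ) : ℕ → ℝ
  | 0 => y
  | n + 1 => 1 / (followQuotients x y n - ⌊completeQuotient x n⌋)

theorem followQuotients_irrational {x y : ℝ} (hy : Irrational y) (n : ℕ) :
    Irrational (followQuotients x y n) := by
  induction n with
  | zero => exact hy
  | succ n ih =>
    rw [followQuotients, one_div, irrational_inv_iff]
    exact ih.sub_intCast _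

/-- One change of basis serves both sides: while `P` carries `(x, -1)` to the row of a complete
quotient, its inverse carries each column `(1, y)ᵗ` along the same steps. -/
theorem exists_rowRel_colRel {x : ℝ} (hx : Irrational x) (n : ℕ) :
    ∃ P Q c, RowRel x (completeQuotient x n) P Q c ∧ ∀ y, Irrational y →
      ∃ ν : ℝ, ν ≠ 0 ∧ toReal Q * !![1; y] = ν • !![followQuotients x y n; 1] := by
  induction n with
  | zero =>
    refine ⟨_, _, _, RowRel.refl x, fun y _ => ⟨1, one_ne_zero, ?_⟩⟩
    ext i j
    fin_cases j
    fin_cases i <;> simp [toReal, Matrix.mul_apply, Fin.sum_univ_two, followQuotients]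
  | succ n ih =>
    obtain ⟨P, Q, c, h, hcol⟩ := ih
    rw [completeQuotient_succ']
    refine ⟨_, _, _, h.mul_quotMat (b := ⌊completeQuotient x n⌋)
      (inv_ne_zero (fract_ne_zero_of_irrational (completeQuotient_irrational hx n)))
      (eq_floor_add_inv _), fun y hy => ?_⟩
    obtain ⟨ν, hν, e⟩ := hcol y hy
    have hne : followQuotients x y n - ⌊completeQuotient x n⌋ ≠ 0 :=
      ((followQuotients_irrational hy n).sub_intCast _).ne_zero
    refine ⟨ν * (followQuotients x y n - ⌊completeQuotient x n⌋), mul_ne_zero hν hne, ?_⟩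
    rw [toReal_mul, Matrix.mul_assoc, e, followQuotients]
    ext i j
    fin_cases j
    fin_cases i
    · simp [toReal, Matrix.mul_apply, Fin.sum_univ_two]
      field_simp
    · simp [toReal, Matrix.mul_apply, Fin.sum_univ_two]
      ring

/-- If `A M` is symmetric, then `A` almost annihilates the kernel point of `M`. -/
theorem exists_coeffNorm_mul_kernelPoint_le {x : ℝ} (hx : Irrational x)
    {M : Matrix (Fin 2) (Fin 2) ℤ} (hM : M.det ≠ 0) :
    ∃ K : ℝ, 0 < K ∧ ∀ A : Matrix (Fin 2) (Fin 2) ℤ, (A * M).IsSymm →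
      coeffNorm (toReal A * !![1; kernelPoint x M]) ≤
        K * coeffNorm (!![x, -1] * toReal A) := by
  have hd := kernelPoint_denom_ne_zero hx hM
  set m := coeffNorm (toReal M)
  have hm : 0 ≤ m := coeffNorm_nonneg _
  set r : ℝ := M 0 1 - x * M 0 0 with hr
  set y := kernelPoint x M with hy
  have hry : r * y = M 1 1 - x * M 1 0 := by
    rw [hy, kernelPoint, mul_div_cancel₀ _ hd]
  have hr0 : 0 < |r| := abs_pos.2 hd
  set K1 := 2 * m / |r| with hK1
  refine ⟨K1 + |x| * K1 + (1 + |y|), by positivity, fun A hA => ?_⟩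
  have r0 := abs_le_coeffNorm (!![x, -1] * toReal A) 0 0
  have r1 := abs_le_coeffNorm (!![x, -1] * toReal A) 0 1
  have hρ0 := coeffNorm_nonneg (!![x, -1] * toReal A)
  set ρ := coeffNorm (!![x, -1] * toReal A)
  simp only [Matrix.mul_apply, Fin.sum_univ_two, toReal, Matrix.map_apply,
    Matrix.of_apply, Matrix.cons_val', Matrix.cons_val_zero, Matrix.cons_val_one,
    Matrix.cons_val_fin_one] at r0 r1
  have hs := hA.apply 0 1
  simp only [Matrix.mul_apply, Fin.sum_univ_two] at hs
  have hs' : (A 1 0 * M 0 0 + A 1 1 * M 1 0 : ℝ) = A 0 0 * M 0 1 + A 0 1 * M 1 1 := by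
    exact_mod_cast hs
  have m0 : |(M 0 0 : ℝ)| ≤ m := abs_le_coeffNorm (toReal M) 0 0
  have m1 : |(M 1 0 : ℝ)| ≤ m := abs_le_coeffNorm (toReal M) 1 0
  have b1 : |(A 0 0 + A 0 1 * y : ℝ)| ≤ K1 * ρ := by
    have e : r * (A 0 0 + A 0 1 * y) =
        -((x * A 0 0 + -1 * A 1 0) * M 0 0 + (x * A 0 1 + -1 * A 1 1) * M 1 0) := by
      linear_combination (A 0 1 : ℝ) * hry - hs' + (A 0 0 : ℝ) * hr
    have h1 : |r| * |(A 0 0 + A 0 1 * y : ℝ)| ≤ 2 * m * ρ := by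
      rw [← abs_mul, e, abs_neg]
      refine (abs_add_le _ _).trans ?_
      rw [abs_mul, abs_mul]
      have := mul_le_mul r0 m0 (abs_nonneg _) hρ0
      have := mul_le_mul r1 m1 (abs_nonneg _) hρ0
      linarith
    rw [hK1, div_mul_eq_mul_div, le_div_iff₀ hr0]
    linarith
  have hK10 : 0 ≤ K1 := by positivity
  have hx0 := abs_nonneg x
  have hy0 := abs_nonneg y
  refine coeffNorm_le (by positivity) fun i j => ?_
  fin_cases j
  fin_cases i
  · have e : (toReal A * !![1; y]) 0 0 = A 0 0 + A 0 1 * y := by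
      simp [toReal, Matrix.mul_apply, Fin.sum_univ_two]
    simp only [Fin.zero_eta, e]
    refine b1.trans ?_
    have : 0 ≤ (|x| * K1 + (1 + |y|)) * ρ := by positivity
    linarith
  · have e : (toReal A * !![1; y]) 1 0 = x * (A 0 0 + A 0 1 * y) -
        ((x * A 0 0 + -1 * A 1 0) + (x * A 0 1 + -1 * A 1 1) * y) := by
      simp [toReal, Matrix.mul_apply, Fin.sum_univ_two]
      ring
    simp only [Fin.mk_one, Fin.zero_eta, e]
    refine (abs_sub _ _).trans ?_
    have h1 := abs_add_le (x * A 0 0 + -1 * A 1 0 : ℝ) ((x * A 0 1 + -1 * A 1 1) * y)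
    rw [abs_mul] at h1
    rw [abs_mul]
    have h2 := mul_le_mul_of_nonneg_left b1 hx0
    have h3 := mul_le_mul_of_nonneg_right r1 hy0
    have h4 : 0 ≤ K1 * ρ := by positivity
    linarith

/-- The Fibonacci sequence of lists with given initial terms. -/
def fibList {E : Type*} (u v : List E) : ℕ → List E
  | 0 => u
  | 1 => v
  | n + 2 => fibList u v (n + 1) ++ fibList u v n

theorem eventually_getElem?_of_occursAt {E : Type*} {u : ℕ → List E}
    (hu : ∀ i, u (i + 2) = u (i + 1) ++ u i) (h : u 0 ++ u 1 ≠ u 1 ++ u 0) {a : ℕ → E}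
    (ha : ∀ i, OccursAt a 0 (u (i + 1))) (n : ℕ) : ∀ᶠ i in atTop, (u i)[n]? = some (a n) := by
  filter_upwards [eventually_ge_atTop (n + 1)] with i hi
  obtain ⟨j, rfl⟩ : ∃ j, i = j + 1 := ⟨i - 1, by omega⟩
  have := ha j n (by have := fib_length hu h j; omega)
  simpa using this

/-- Conjugation brings the sequence to coordinates where the approximate left and right kernels have
the position required by `exists_bound_isContinuant`, so that its late terms are word matrices up to
sign. -/
theorem exists_fibonacci_of_isAssociated {x : ℝ} (hext : IsExtremal x) {W : ℕ → PrimMat}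
    (hW : IsAssociated W x) (hunit : ∀ i, IsUnit (W i).1) :
    ∃ (u : ℕ → List ℕ+) (a : ℕ → ℕ+), (∀ i, u (i + 2) = u (i + 1) ++ u i) ∧
      u 0 ++ u 1 ≠ u 1 ++ u 0 ∧ (∀ i, OccursAt a 0 (u (i + 1))) ∧ PartialQuotientsAgree x a := by
  obtain ⟨hx, hquad, -⟩ := hext
  obtain ⟨⟨hfib, N, hN1, hN2, hNs⟩, hunb, ⟨c1, _, hc1, _, hgrow⟩, ⟨_, C, _, hC, hrow⟩, -⟩ := hW
  obtain ⟨V, hVW⟩ : ∃ V : ℕ → Matrix (Fin 2) (Fin 2) ℤ, V = fun i => (W i).1 := ⟨_, rfl⟩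
  have hdet : ∀ i, IsUnit (V i).det := fun i => by
    rw [hVW]
    exact (Matrix.isUnit_iff_isUnit_det _).1 (hunit i)
  have hV : IsFibonacci V := by
    intro i
    have h1 : (W (i + 2)).1 = red ((W (i + 1)).1 * (W i).1) := congrArg Subtype.val (hfib i)
    have h2 : content (V (i + 1) * V i) = 1 := by
      apply content_eq_one_of_isUnit
      rw [Matrix.det_mul]
      exact (hdet _).mul (hdet _)
    rw [hVW] at h2 ⊢
    rw [← red_eq_self h2]
    exact h1
  have hsymm : ∀ i, (V i * altMat N.1 i).IsSymm := by
    rw [hVW]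
    exact hNs
  have hrow' : ∀ i, coeffNorm (!![x, -1] * toReal (V i)) ≤ C * (coeffNorm (toReal (V i)))⁻¹ := by
    rw [hVW]
    exact fun i => (hrow i).2
  have hXtop : Tendsto (fun i => coeffNorm (toReal (V i))) atTop atTop := by
    rw [hVW]
    exact tendsto_atTop_of_comparable (fun i => one_le_coeffNorm (W i).2.2) hunb hc1
      fun i => (hgrow i).1
  clear hVW hfib hNs hunb hgrow hrow hunit
  have hrow0 : Tendsto (fun i => coeffNorm (!![x, -1] * toReal (V i))) atTop (𝓝 0) := by
    refine squeeze_zero (fun i => coeffNorm_nonneg _) hrow' ?_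
    simpa using (tendsto_inv_atTop_zero.comp hXtop).const_mul C
  -- a common complete quotient at which both kernel points lie in `(-1, 0)`
  have hsep : ∀ M : Matrix (Fin 2) (Fin 2) ℤ, M.det ≠ 0 → Mᵀ ≠ -M →
      ∃ k, ∀ n, k ≤ n → -1 < followQuotients x (kernelPoint x M) n ∧
        followQuotients x (kernelPoint x M) n < 0 := fun M hM hMt =>
    eventually_neg_of_ne hx (kernelPoint_ne hx hquad hM hMt)
      (followQuotients_irrational (kernelPoint_irrational hx hM)) fun n => rfl
  have hNt : (N.1ᵀ)ᵀ ≠ -N.1ᵀ := by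
    intro h
    rw [Matrix.transpose_transpose] at h
    exact hN2 (by rw [h, neg_neg, ← h])
  have hNd : N.1ᵀ.det ≠ 0 := by
    rw [Matrix.det_transpose]
    exact N.2.2
  obtain ⟨k0, hk0⟩ := hsep N.1 N.2.2 hN2
  obtain ⟨k1, hk1⟩ := hsep N.1ᵀ hNd hNt
  -- The added `1` makes `t` a complete quotient of positive index, hence greater than `1`.
  obtain ⟨k, hkk⟩ : ∃ k, k = max k0 k1 + 1 := ⟨_, rfl⟩
  obtain ⟨P, Q, c, hP, hcol⟩ := exists_rowRel_colRel hx k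
  obtain ⟨t, ht⟩ : ∃ t, t = completeQuotient x k := ⟨_, rfl⟩
  rw [← ht] at hP
  have ht1 : 1 < t := by
    rw [ht, hkk, completeQuotient_succ']
    exact one_lt_inv_fract (fract_ne_zero_of_irrational (completeQuotient_irrational hx _))
  have htirr : Irrational t := ht ▸ completeQuotient_irrational hx k
  set A : ℕ → Matrix (Fin 2) (Fin 2) ℤ := fun i => Q * V i * P with hA
  have hAfib : IsFibonacci A := by
    intro i
    simp only [hA, inner_conj_mul hP.mul_eq, hV i]
  have hAtop : Tendsto (fun i => coeffNorm (toReal (A i))) atTop atTop := by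
    have hPn := one_le_coeffNorm hP.det_ne_zero.1
    have hQn := one_le_coeffNorm hP.det_ne_zero.2
    have hpos : 0 < 4 * coeffNorm (toReal P) * coeffNorm (toReal Q) := by positivity
    refine tendsto_atTop_mono (fun i => ?_) (hXtop.atTop_div_const hpos)
    rw [div_le_iff₀' hpos]
    have := coeffNorm_conj_le P Q (A i)
    rwa [inner_conj_cancel hP.mul_eq] at this
  have hArow : Tendsto (fun i => coeffNorm (!![1, -t] * toReal (A i))) atTop (𝓝 0) := by
    have h1 := hrow0.const_mul (2 * |c⁻¹| * coeffNorm (toReal P))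
    rw [mul_zero] at h1
    refine squeeze_zero (fun i => coeffNorm_nonneg _) (fun i => ?_) h1
    have e : !![1, -t] * toReal (A i) = (c⁻¹ • (!![x, -1] * toReal (V i))) * toReal P := by
      have e1 : !![1, -t] = c⁻¹ • (!![x, -1] * toReal P) := by
        rw [hP.row, smul_smul, inv_mul_cancel₀ hP.ne_zero, one_smul]
      have e2 : toReal P * toReal (A i) = toReal (V i) * toReal P := by
        rw [← toReal_mul, ← toReal_mul]
        congr 1
        simp only [hA, ← mul_assoc, hP.mul_eq, one_mul]
      rw [e1, Matrix.smul_mul, Matrix.mul_assoc, e2, Matrix.smul_mul, Matrix.mul_assoc]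
    have h2 : coeffNorm (c⁻¹ • (!![x, -1] * toReal (V i))) ≤
        |c⁻¹| * coeffNorm (!![x, -1] * toReal (V i)) := by
      refine coeffNorm_le (mul_nonneg (abs_nonneg _) (coeffNorm_nonneg _)) fun j l => ?_
      rw [Matrix.smul_apply, smul_eq_mul, abs_mul]
      exact mul_le_mul_of_nonneg_left (abs_le_coeffNorm _ j l) (abs_nonneg _)
    rw [e]
    have h3 := coeffNorm_mul_le (c⁻¹ • (!![x, -1] * toReal (V i))) (toReal P)
    have h4 := mul_le_mul_of_nonneg_right h2 (coeffNorm_nonneg (toReal P))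
    linarith
  have hev : ∀ M : Matrix (Fin 2) (Fin 2) ℤ, M.det ≠ 0 →
      -1 < followQuotients x (kernelPoint x M) k → followQuotients x (kernelPoint x M) k < 0 →
      ∀ᶠ i in atTop, altMat N.1 i = M → IsContinuant (A i) ∨ IsContinuant (-A i) := by
    intro M hM hy1 hy0
    obtain ⟨K, hK, hKb⟩ := exists_coeffNorm_mul_kernelPoint_le hx hM
    obtain ⟨ν, hν, hνe⟩ := hcol _ (kernelPoint_irrational hx hM)
    obtain ⟨R, hR⟩ := exists_bound_isContinuant ht1 hy1 hy0
    have h1 := hrow0.const_mul (|ν⁻¹| * (2 * coeffNorm (toReal Q) * K))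
    rw [mul_zero] at h1
    filter_upwards [hAtop.eventually_gt_atTop R, hArow.eventually_le_const one_pos,
      h1.eventually_le_const one_pos] with i hi1 hi2 hi3 hiM
    refine hR (A i) hi1 hi2 (le_trans ?_ hi3)
    have hs := hsymm i
    rw [hiM] at hs
    have hb := hKb (V i) hs
    have e : toReal (A i) * !![followQuotients x (kernelPoint x M) k; 1] =
        ν⁻¹ • (toReal Q * (toReal (V i) * !![1; kernelPoint x M])) := by
      have e1 : !![followQuotients x (kernelPoint x M) k; 1] =
          ν⁻¹ • (toReal Q * !![1; kernelPoint x M]) := by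
        rw [hνe, smul_smul, inv_mul_cancel₀ hν, one_smul]
      have e2 : toReal (A i) * toReal Q = toReal Q * toReal (V i) := by
        rw [← toReal_mul, ← toReal_mul]
        congr 1
        simp only [hA, mul_assoc, hP.mul_eq, mul_one]
      rw [e1, Matrix.mul_smul, ← Matrix.mul_assoc, e2, Matrix.mul_assoc]
    rw [e]
    have hρ := coeffNorm_nonneg (!![x, -1] * toReal (V i))
    have hQ := coeffNorm_nonneg (toReal Q)
    have h2 : coeffNorm (toReal Q * (toReal (V i) * !![1; kernelPoint x M])) ≤
        2 * coeffNorm (toReal Q) * K * coeffNorm (!![x, -1] * toReal (V i)) := by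
      refine (coeffNorm_mul_le _ _).trans ?_
      rw [mul_assoc _ K]
      exact mul_le_mul_of_nonneg_left hb (by positivity)
    refine coeffNorm_le (by positivity) fun j l => ?_
    rw [Matrix.smul_apply, smul_eq_mul, abs_mul, mul_assoc |ν⁻¹|]
    exact mul_le_mul_of_nonneg_left ((abs_le_coeffNorm _ j l).trans h2) (abs_nonneg _)
  have hk0' := hk0 k (by omega)
  have hk1' := hk1 k (by omega)
  obtain ⟨i0, hi0⟩ := eventually_atTop.1
    ((hev N.1 N.2.2 hk0'.1 hk0'.2).and (hev N.1ᵀ hNd hk1'.1 hk1'.2))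
  have hAc : ∀ i, i0 ≤ i → ∃ u : List ℕ+, A i = wordMat u ∨ A i = -wordMat u := by
    intro i hi
    have hAdet : IsUnit (A i).det := by
      simp only [hA, Matrix.det_mul]
      have hPQ : IsUnit (P.det * Q.det) := by
        rw [← Matrix.det_mul, hP.mul_eq, Matrix.det_one]
        exact isUnit_one
      exact ((isUnit_of_mul_isUnit_right hPQ).mul (hdet i)).mul (isUnit_of_mul_isUnit_left hPQ)
    have hneg : (-A i).det = (A i).det := by simp [Matrix.det_fin_two]
    have hcont : IsContinuant (A i) ∨ IsContinuant (-A i) := by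
      by_cases he : Even i
      · exact (hi0 i hi).2 (by simp [altMat, he])
      · exact (hi0 i hi).1 (by simp [altMat, he])
    rcases hcont with h | h
    · obtain ⟨b, u, hu⟩ := h.exists_wordMat (Int.isUnit_iff.1 hAdet)
      exact ⟨b :: u, Or.inl hu.symm⟩
    · obtain ⟨b, u, hu⟩ := h.exists_wordMat (by rw [hneg]; exact Int.isUnit_iff.1 hAdet)
      exact ⟨b :: u, Or.inr (by rw [hu, neg_neg])⟩
  obtain ⟨u0, hu0⟩ := hAc i0 le_rfl
  obtain ⟨u1, hu1⟩ := hAc (i0 + 1) (by omega)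
  -- Only two consecutive words are chosen; multiplicativity identifies the later ones, the signs
  -- multiplying along.
  set u := fibList u0 u1 with hu
  have hufib : ∀ i, u (i + 2) = u (i + 1) ++ u i := fun i => rfl
  have huA : ∀ i, A (i0 + i) = wordMat (u i) ∨ A (i0 + i) = -wordMat (u i) := by
    intro i
    induction i using Nat.twoStepInduction with
    | zero => exact hu0
    | one => exact hu1
    | more i ih1 ih2 =>
      rw [← add_assoc, hAfib, hufib, wordMat_append, add_assoc]
      rcases ih1 with h1 | h1 <;> rcases ih2 with h2 | h2 <;> simp [h1, h2]
  have hcomm : u 0 ++ u 1 ≠ u 1 ++ u 0 := by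
    intro h
    have h1 : wordMat (u 0) * wordMat (u 1) = wordMat (u 1) * wordMat (u 0) := by
      rw [← wordMat_append, h, wordMat_append]
    have h2 : A i0 * A (i0 + 1) = A (i0 + 1) * A i0 := by
      have e0 := huA 0
      have e1 := huA 1
      rw [add_zero] at e0
      rcases e0 with e0 | e0 <;> rcases e1 with e1 | e1 <;> simp [e0, e1, h1]
    have h3 : V i0 * V (i0 + 1) = V (i0 + 1) * V i0 := by
      simp only [hA, inner_conj_mul hP.mul_eq] at h2
      have := congrArg (fun Z => P * Z * Q) h2
      simpa only [inner_conj_cancel hP.mul_eq] using this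
    -- If `V i0` and `V (i0 + 1)` commuted, cancelling their product here would give `N = Nᵀ`.
    have h4 := mul_altMat_add_two hV hsymm i0
    rw [altMat_add_two, hV i0, ← mul_assoc, h3] at h4
    have h5 : altMat N.1 i0 = altMat N.1 (i0 + 1) := by
      have hd : (V (i0 + 1) * V i0).det ≠ 0 := by
        rw [Matrix.det_mul]
        exact ((hdet _).mul (hdet _)).ne_zero
      have := congrArg (fun Z => (V (i0 + 1) * V i0).adjugate * Z) h4
      simp only [← mul_assoc, ← mul_assoc (V (i0 + 1) * V i0).adjugate (V (i0 + 1) * V i0)] at this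
      rw [mul_assoc _ (V (i0 + 1)) (V i0), Matrix.adjugate_mul, smul_mul_assoc, smul_mul_assoc,
        one_mul, one_mul] at this
      exact smul_right_injective _ hd this
    rw [altMat_succ] at h5
    unfold altMat at h5
    split_ifs at h5
    · exact hN1 (by rw [h5, Matrix.transpose_transpose])
    · exact hN1 h5.symm
  obtain ⟨a, ha⟩ := fib_exists_limit hufib hcomm
  refine ⟨u, a, hufib, hcomm, ha, k, 0, fun i => ?_⟩
  have hlim : Tendsto (fun i => (wordMat (u i) 0 0 : ℝ) - t * (wordMat (u i) 1 0 : ℝ))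
      atTop (𝓝 0) := by
    rw [tendsto_zero_iff_abs_tendsto_zero]
    have h1 := (tendsto_add_atTop_iff_nat i0).2 hArow
    refine squeeze_zero (fun i => abs_nonneg _) (fun i => ?_) h1
    refine le_trans (le_of_eq ?_) (abs_le_coeffNorm _ 0 0)
    rw [add_comm i i0]
    rcases huA i with h | h
    · rw [h]
      simp [Matrix.mul_apply, Fin.sum_univ_two, toReal]
      ring_nf
    · rw [h, ← abs_neg]
      simp [Matrix.mul_apply, Fin.sum_univ_two, toReal]
      ring_nf
  have := floor_completeQuotient_of_tendsto i htirr
    (eventually_getElem?_of_occursAt hufib hcomm ha) hlim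
  rw [partialQuotient_of_irrational hx, completeQuotient_add, ← ht, this, zero_add]
  simp

end

/-! ### Passage between free monoid and lists, and conclusion -/

theorem mainTheorem2 :
    (∀ ξ : ℝ,
      (IsExtremal ξ ∧ ∃ W : ℕ → PrimMat, IsAssociated W ξ ∧ ∀ i, IsUnit (W i).1) ↔
        ∃ (w : ℕ → FreeMonoid ℕ+) (a : ℕ → ℕ+),
          IsFibonacci w ∧ w 0 * w 1 ≠ w 1 * w 0 ∧ IsLimitWord w a ∧
            PartialQuotientsAgree ξ a) ∧
    (∀ w : ℕ → FreeMonoid ℕ+, IsFibonacci w → w 0 * w 1 ≠ w 1 * w 0 →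
      ∃ a : ℕ → ℕ+, IsLimitWord w a ∧ ¬ UltimatelyPeriodic a) := by
  have hlist : ∀ w : ℕ → FreeMonoid ℕ+, IsFibonacci w → w 0 * w 1 ≠ w 1 * w 0 →
      ∃ u : ℕ → List ℕ+, (∀ i, FreeMonoid.toList (w i) = u i) ∧
        (∀ i, u (i + 2) = u (i + 1) ++ u i) ∧ u 0 ++ u 1 ≠ u 1 ++ u 0 := by
    intro w hw hc
    refine ⟨fun i => FreeMonoid.toList (w i), fun i => rfl, fun i => ?_, fun h => hc ?_⟩
    · simp only [hw i, FreeMonoid.toList_mul]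
    · apply FreeMonoid.toList.injective
      rw [FreeMonoid.toList_mul, FreeMonoid.toList_mul]
      exact h
  refine ⟨fun ξ => ⟨?_, ?_⟩, ?_⟩
  · rintro ⟨hext, W, hW, hunit⟩
    obtain ⟨u, a, hu, hc, ha, hag⟩ := exists_fibonacci_of_isAssociated hext hW hunit
    refine ⟨fun i => FreeMonoid.ofList (u i), a, fun i => ?_, fun h => hc ?_, fun n => ?_, hag⟩
    · simp only [hu i, FreeMonoid.ofList_append]
    · apply FreeMonoid.ofList.injective
      rw [FreeMonoid.ofList_append, FreeMonoid.ofList_append]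
      exact h
    · simpa using eventually_getElem?_of_occursAt hu hc ha n
  · rintro ⟨w, a, hw, hc, hlim, hag⟩
    obtain ⟨u, hwu, hu, hcu⟩ := hlist w hw hc
    obtain ⟨a', ha'⟩ := fib_exists_limit hu hcu
    have haa : a' = a := by
      funext n
      have h1 := hlim n
      simp only [hwu] at h1
      obtain ⟨i, h1, h2⟩ := (h1.and (eventually_getElem?_of_occursAt hu hcu ha' n)).exists
      rw [h1, Option.some_inj] at h2
      exact h2.symm
    rw [haa] at ha'
    obtain ⟨s, P, Q, c, hs, hP⟩ := exists_quotientSeq_of_agree hag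
    -- The sequence is shifted by one so that all its terms are prefixes of the limit word;
    -- non-commutation survives the shift.
    exact exists_isAssociated (u := fun i => u (i + 1)) (fun i => hu (i + 1))
      (fun h => hcu (fib_comm_zero hu 1 h)) ha' hs hP
  · intro w hw hc
    obtain ⟨u, hwu, hu, hcu⟩ := hlist w hw hc
    obtain ⟨a, ha⟩ := fib_exists_limit hu hcu
    refine ⟨a, fun n => ?_, fib_not_ultimatelyPeriodic hu hcu ha⟩
    simp only [hwu]
    exact eventually_getElem?_of_occursAt hu hcu ha n
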